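/- \textbf{Setting.} Let $n\ge 1$ (horizon), $m=n_u=n_y$, $n_d,n_z\ge 0$ be integers, $\Delta>0$, and $\underline u,\overline u\in\mathbb R^m$ with $\underline u_{(i)}<\overline u_{(i)}$ for all $i$; $\mathcal U=\{u:\underline u\le u\le\overline u\}$. A \emph{bijective neural network} (BNN) on $\mathbb R^m$ conditioned on $\eta\in\mathbb R^{n_d}$ is a map $f(\xi;\eta)=\xi^{(L)}$ with $\xi^{(0)}=\xi$, $\xi^{(i)}=\varphi^{(i)}(\Omega^{(i)}(\eta)\xi^{(i-1)}+\beta^{(i)}(\eta),\eta)$, where $\Omega^{(i)}(\eta)$ is nonsingular and $\varphi^{(i)}(\cdot,\eta)$ acts elementwise and is bijective. It is \emph{diagonal} if all $\Omega^{(i)}(\eta)$ are diagonal, and \emph{of class $C^2$} if all $\varphi^{(i)}$ (jointly in both variables), $\Omega^{(i)},\beta^{(i)}$ are $C^2$. A \emph{$C^2$ partially input convex neural network} (PICNN) $\Xi(\xi,\eta)=\zeta^{(L)}$ is given by $\zeta^{(0)}=\xi$, $\eta^{(0)}=\eta$, $\eta^{(i)}=\varphi_\eta^{(i)}(W_\eta^{(i)}\eta^{(i-1)}+b_\eta^{(i)})$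 and $$\zeta^{(i)}=\varphi_\zeta^{(i)}\big(W_\zeta^{(i)}(\zeta^{(i-1)}\odot\mathrm{softplus}(v_\zeta^{(i)}))+W_\xi^{(i)}(\xi\odot v_\xi^{(i)})+v_\eta^{(i)}\big),$$ where $v_\zeta^{(i)},v_\xi^{(i)},v_\eta^{(i)}$ are affine functions of $\eta^{(i-1)}$, $\mathrm{softplus}(t)=\log(1+e^t)$ is applied elementwise, $\odot$ is the elementwise product, the entries of $W_\zeta^{(i)}$ are nonnegative, $\varphi_\zeta^{(i)}$ is non-decreasing, convex and $C^2$, and $\varphi_\eta^{(i)}$ is $C^2$. Let $\Psi$ be a diagonal BNN of class $C^2$ whose Jacobian $\partial\Psi/\partial u(u;d)$ is nonsingular for all $(u,d)$, let $\Phi$ be a BNN of class $C^2$, and let $\Xi((x,v),d)\in\mathbb R^{n_z}$ be a $C^2$ PICNN in $\xi=(x,v)\in\mathbb R^{2m}$, $\eta=d$. Let $A(d),B(d)\in\mathbb R^{m\times m}$ and $c(d)\in\mathbb R^m$ be locally Lipschitz in $d\in\mathbb R^{n_d}$, and set $A_\Delta=e^{A\Delta}$, $B_\Delta=\big(\int_0^\Delta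 e^{A(\Delta-\tau)}d\tau\big)B$, $c_\Delta=\big(\int_0^\Delta e^{A(\Delta-\tau)}d\tau\big)c$. Let $\mathcal P$ be the set of parameters $p=(x_0,\bar d,\bar r)\in\mathbb R^m\times\mathbb R^{n_d}\times\mathbb R^m$ for which $B_\Delta(\bar d)$ is nonsingular. For $p\in\mathbb R^m\times\mathbb R^{n_d}\times\mathbb R^m$ and $V=(v_0,\dots,v_{n-1})\in\mathbb R^{nm}$ let $x_{k+1}=A_\Delta(\bar d)x_k+B_\Delta(\bar d)v_k+c_\Delta(\bar d)$, $E=(x_k-\Phi(\bar r;\bar d))_{k=1}^{n}$, $Z=(\Xi((x_k,v_k),\bar d))_{k=0}^{n-1}$, $U=(\Psi^{-1}(v_k;\bar d))_{k=0}^{n-1}$ and $$f(V;p)=E^{\rm T}QE+f_u(U,\bar d)+f_z(Z).$$ Here $Q=Q(p)$ is symmetric positive definite for $p\in\mathcal P$ and locally Lipschitz on $\mathcal P$ (for instance constant); the input cost expressed in $V$, $f_v(V,d):=f_u\big((\Psi^{-1}(v_k;d))_{k},d\big)$, is jointly $C^2$ and convex in $V$; $f_z$ is $C^2$, convex and non-decreasing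 in each variable. Since $\Psi$ is diagonal, the constraints $u_k\in\mathcal U$ $(k=0,\dots,n-1)$ are equivalent to $\underline v(\bar d)\le v_k\le\overline v(\bar d)$, where $\underline v,\overline v$ are the elementwise minimum and maximum of $\Psi(\underline u;\bar d)$ and $\Psi(\overline u;\bar d)$. Write them as $g(V;p)\le 0$ with $g=(v_k-\overline v,\ \underline v-v_k)_{k}\in\mathbb R^{2nm}$, put $L(V,\lambda;p)=f(V;p)+\lambda^{\rm T}g(V;p)$, and, with $\phi(a,b)=a+b-\sqrt{a^2+b^2}$ applied elementwise, $$F(V,\lambda;p)=\begin{bmatrix}(\partial L/\partial V)^{\rm T}\\ \phi(\lambda,-g)\end{bmatrix}.$$ \textbf{Theorem.} For every $p=(x_0,\bar d,\bar r)\in\mathcal P$ the system $F(V,\lambda;p)=0$ has a unique solution $\tilde V^*(p)=(V^*,\lambda^*)$, and the control law $$u(x_0,\bar d,\bar r)=\Psi^{-1}\big(\tilde V^*_{1:n_u}(p);\bar d\big),$$ where $\tilde V^*_{1:n_u}$ denotes the first $n_u$ entries of $\tilde V^*$ (that is, $v_0^*$), is locally Lipschitz continuous on $\mathcal P$. -/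

import Mathlib

open Set Matrix

noncomputable section

namespace HW

/-! ## Bijective neural networks -/

/-- One layer `ξ ↦ φ(Ω(η) ξ + β(η), η)` of a bijective neural network on `ℝᵐ` with
conditioning variable `η ∈ ℝᵖ`. The activation acts elementwise: its `j`-th entry is
`φ j (ξ j) η`. -/
structure BNNLayer (m p : ℕ) where
  φ : Fin m → ℝ → (Fin p → ℝ) → ℝ
  Ω : (Fin p → ℝ) → Matrix (Fin m) (Fin m) ℝ
  β : (Fin p → ℝ) → (Fin m → ℝ)
  nonsingular : ∀ η, IsUnit (Ω η)
  bijective : ∀ j η, Function.Bijective (fun t => φ j t η)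

/-- The map computed by a layer. -/
def BNNLayer.eval {m p : ℕ} (l : BNNLayer m p) (ξ : Fin m → ℝ) (η : Fin p → ℝ) : Fin m → ℝ :=
  fun j => l.φ j ((l.Ω η *ᵥ ξ + l.β η) j) η

/-- A bijective neural network: a finite list of layers, applied from the head on. -/
structure BNN (m p : ℕ) where
  layers : List (BNNLayer m p)

/-- The function `f(ξ; η)` computed by a bijective neural network. -/
def BNN.eval {m p : ℕ} (N : BNN m p) (ξ : Fin m → ℝ) (η : Fin p → ℝ) : Fin m → ℝ :=
  N.layers.foldl (fun ζ l => l.eval ζ η) ξ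

/-- All the weighting matrices are diagonal. -/
def BNN.IsDiagonal {m p : ℕ} (N : BNN m p) : Prop :=
  ∀ l ∈ N.layers, ∀ η, (l.Ω η).IsDiag

/-- All activations, weighting matrices and biases are of class `C^r` (the activations jointly
in both variables). -/
def BNN.IsOfClass {m p : ℕ} (r : WithTop ℕ∞) (N : BNN m p) : Prop :=
  ∀ l ∈ N.layers,
    (∀ j, ContDiff ℝ r (fun q : ℝ × (Fin p → ℝ) => l.φ j q.1 q.2)) ∧
    (∀ i j, ContDiff ℝ r (fun η => l.Ω η i j)) ∧
    ContDiff ℝ r l.β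

theorem BNNLayer.eval_bijective {m p : ℕ} (l : BNNLayer m p) (η : Fin p → ℝ) :
    Function.Bijective (fun ξ => l.eval ξ η) := by
  have h1 : Function.Bijective (fun ξ : Fin m → ℝ => l.Ω η *ᵥ ξ) := by
    refine ⟨Matrix.mulVec_injective_of_isUnit (l.nonsingular η), ?_⟩
    exact Matrix.mulVec_surjective_iff_isUnit.mpr (l.nonsingular η)
  have h2 : Function.Bijective (fun ξ : Fin m → ℝ => ξ + l.β η) :=
    (Equiv.addRight (l.β η)).bijective
  have h3 : Function.Bijective (fun ξ : Fin m → ℝ => fun j => l.φ j (ξ j) η) :=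
    Function.Bijective.piMap (fun j => l.bijective j η)
  exact h3.comp (h2.comp h1)

theorem BNN.eval_bijective {m p : ℕ} (N : BNN m p) (η : Fin p → ℝ) :
    Function.Bijective (fun ξ => N.eval ξ η) := by
  obtain ⟨ls⟩ := N
  unfold BNN.eval
  induction ls with
  | nil => exact Function.bijective_id
  | cons l ls ih => exact ih.comp (l.eval_bijective η)

/-- The inverse `f⁻¹(· ; η)` of a bijective neural network in its first variable. -/
def BNN.inv {m p : ℕ} (N : BNN m p) (ζ : Fin m → ℝ) (η : Fin p → ℝ) : Fin m → ℝ :=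
  (Equiv.ofBijective _ (N.eval_bijective η)).symm ζ

/-! ## Partially input convex neural networks -/

/-- `softplus v = log (1 + e^v)`. -/
def softplus (v : ℝ) : ℝ := Real.log (1 + Real.exp v)

/-- One layer of a `C^r` partially input convex neural network with network input `ξ ∈ ℝ^q`,
sending `ζ ∈ ℝ^a`, `η ∈ ℝ^b` to `ζ' ∈ ℝ^a'`, `η' ∈ ℝ^b'`. -/
structure PICNNLayer (r : WithTop ℕ∞) (q a b a' b' : ℕ) where
  φζ : (Fin a' → ℝ) → (Fin a' → ℝ)
  φη : (Fin b' → ℝ) → (Fin b' → ℝ)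
  Wζ : Matrix (Fin a') (Fin a) ℝ
  Wξ : Matrix (Fin a') (Fin q) ℝ
  Wη : Matrix (Fin b') (Fin b) ℝ
  Wζη : Matrix (Fin a) (Fin b) ℝ
  Wξη : Matrix (Fin q) (Fin b) ℝ
  Wηη : Matrix (Fin a') (Fin b) ℝ
  bη : Fin b' → ℝ
  bζη : Fin a → ℝ
  bξη : Fin q → ℝ
  bηη : Fin a' → ℝ
  φζ_mono : Monotone φζ
  φζ_convex : ConvexOn ℝ univ φζ
  φζ_contDiff : ContDiff ℝ r φζ
  φη_contDiff : ContDiff ℝ r φη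
  Wζ_nonneg : ∀ i j, 0 ≤ Wζ i j

/-- The new `ζ`:
`φζ (Wζ (ζ ⊙ softplus (Wζη η + bζη)) + Wξ (ξ ⊙ (Wξη η + bξη)) + (Wηη η + bηη))`. -/
def PICNNLayer.nextζ {r : WithTop ℕ∞} {q a b a' b' : ℕ} (l : PICNNLayer r q a b a' b')
    (ξ : Fin q → ℝ) (ζ : Fin a → ℝ) (η : Fin b → ℝ) : Fin a' → ℝ :=
  l.φζ (l.Wζ *ᵥ (fun i => ζ i * softplus ((l.Wζη *ᵥ η + l.bζη) i))
    + l.Wξ *ᵥ (fun i => ξ i * (l.Wξη *ᵥ η + l.bξη) i)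
    + (l.Wηη *ᵥ η + l.bηη))

/-- The new `η`: `φη (Wη η + bη)`. -/
def PICNNLayer.nextη {r : WithTop ℕ∞} {q a b a' b' : ℕ} (l : PICNNLayer r q a b a' b')
    (η : Fin b → ℝ) : Fin b' → ℝ :=
  l.φη (l.Wη *ᵥ η + l.bη)

/-- A chain of layers from widths `(a, b)` to output width `c`; the `η`-output of the last layer
is discarded. -/
inductive PICNNChain (r : WithTop ℕ∞) (q c : ℕ) : ℕ → ℕ → Type
  | output (b : ℕ) : PICNNChain r q c c b
  | layer {a b a' b' : ℕ} (l : PICNNLayer r q a b a' b') (rest : PICNNChain r q c a' b') :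
      PICNNChain r q c a b

/-- The last `ζ` of a chain. -/
def PICNNChain.eval {r : WithTop ℕ∞} {q c : ℕ} (ξ : Fin q → ℝ) :
    {a b : ℕ} → PICNNChain r q c a b → (Fin a → ℝ) → (Fin b → ℝ) → (Fin c → ℝ)
  | _, _, .output _, ζ, _ => ζ
  | _, _, .layer l rest, ζ, η => rest.eval ξ (l.nextζ ξ ζ η) (l.nextη η)

/-- A `C^r` partially input convex neural network `ℝ^q × ℝ^p → ℝ^c`. -/
abbrev PICNN (r : WithTop ℕ∞) (q p c : ℕ) := PICNNChain r q c q p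

/-- The network is started at `ζ = ξ`. -/
def PICNN.eval {r : WithTop ℕ∞} {q p c : ℕ} (N : PICNN r q p c)
    (ξ : Fin q → ℝ) (η : Fin p → ℝ) : Fin c → ℝ :=
  PICNNChain.eval ξ N ξ η

/-! ## The optimal control problem -/

/-- The parameters `(x₀, d, r)` of the optimal control problem. -/
abbrev Param (m nd : ℕ) := (Fin m → ℝ) × (Fin nd → ℝ) × (Fin m → ℝ)

/-- The multiplier space: one entry per upper bound, one per lower bound. -/
abbrev Mult (n m : ℕ) := ((Fin n × Fin m) ⊕ (Fin n × Fin m)) → ℝ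

/-- The Fischer–Burmeister function. -/
def fischerBurmeister (a b : ℝ) : ℝ := a + b - Real.sqrt (a ^ 2 + b ^ 2)

/-- The data of a structured Hammerstein–Wiener model (`m = n_u = n_y`) with sampling period `Δ`
and of the finite-horizon problem with horizon `n`. The weight `Q` may depend on the parameters,
the input cost `fu` on the disturbance. -/
structure OCP (n m nd nz : ℕ) where
  Ψ : BNN m nd
  Φ : BNN m nd
  Ξ : PICNN 2 (m + m) nd nz
  A : (Fin nd → ℝ) → Matrix (Fin m) (Fin m) ℝ
  B : (Fin nd → ℝ) → Matrix (Fin m) (Fin m) ℝ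
  c : (Fin nd → ℝ) → (Fin m → ℝ)
  Δ : ℝ
  Q : Param m nd → Matrix (Fin n × Fin m) (Fin n × Fin m) ℝ
  fu : (Fin n → Fin m → ℝ) → (Fin nd → ℝ) → ℝ
  fz : (Fin n → Fin nz → ℝ) → ℝ
  ulo : Fin m → ℝ
  uhi : Fin m → ℝ

namespace OCP

variable {n m nd nz : ℕ} (P : OCP n m nd nz)

/-- `A_Δ = e^{AΔ}`. -/
def AΔ (d : Fin nd → ℝ) : Matrix (Fin m) (Fin m) ℝ := NormedSpace.exp (P.Δ • P.A d)

/-- `∫₀^Δ e^{A(Δ-τ)} dτ`, entrywise. -/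
def intExp (d : Fin nd → ℝ) : Matrix (Fin m) (Fin m) ℝ :=
  Matrix.of fun i j => ∫ τ in (0 : ℝ)..P.Δ, NormedSpace.exp ((P.Δ - τ) • P.A d) i j

/-- `B_Δ = (∫₀^Δ e^{A(Δ-τ)} dτ) B`. -/
def BΔ (d : Fin nd → ℝ) : Matrix (Fin m) (Fin m) ℝ := P.intExp d * P.B d

/-- `c_Δ = (∫₀^Δ e^{A(Δ-τ)} dτ) c`. -/
def cΔ (d : Fin nd → ℝ) : Fin m → ℝ := P.intExp d *ᵥ P.c d

/-- The state `x_k` (for `k ≤ n`) under `x_{k+1} = A_Δ x_k + B_Δ v_k + c_Δ`. -/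
def state (x₀ : Fin m → ℝ) (d : Fin nd → ℝ) (V : Fin n → Fin m → ℝ) : ℕ → Fin m → ℝ
  | 0 => x₀
  | k + 1 => P.AΔ d *ᵥ state x₀ d V k
      + P.BΔ d *ᵥ (if h : k < n then V ⟨k, h⟩ else 0) + P.cΔ d

/-- The tracking error `E = X - 1 ⊗ Φ(r; d)`, where `X = (x₁, …, x_n)`. -/
def err (V : Fin n → Fin m → ℝ) (p : Param m nd) : Fin n × Fin m → ℝ :=
  fun ki => P.state p.1 p.2.1 V (ki.1 + 1) ki.2 - P.Φ.eval p.2.2 p.2.1 ki.2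

/-- `Z = (z₀, …, z_{n-1})` with `z_k = Ξ(x_k, v_k; d)`. -/
def outZ (V : Fin n → Fin m → ℝ) (p : Param m nd) : Fin n → Fin nz → ℝ :=
  fun k => P.Ξ.eval (Fin.append (P.state p.1 p.2.1 V k) (V k)) p.2.1

/-- The input cost as a function of `V`: `f_v(V; d) = f_u(U)` with `u_k = Ψ⁻¹(v_k; d)`. -/
def fv (V : Fin n → Fin m → ℝ) (d : Fin nd → ℝ) : ℝ := P.fu (fun k => P.Ψ.inv (V k) d) d

/-- The cost `f = Eᵀ Q E + f_u(U) + f_z(Z)` as a function of `V`. -/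
def cost (V : Fin n → Fin m → ℝ) (p : Param m nd) : ℝ :=
  P.err V p ⬝ᵥ (P.Q p *ᵥ P.err V p) + P.fv V p.2.1 + P.fz (P.outZ V p)

/-- Lower bound on `v_k`: the elementwise minimum of the images of the two bounds on `u`. -/
def vlo (d : Fin nd → ℝ) : Fin m → ℝ := P.Ψ.eval P.ulo d ⊓ P.Ψ.eval P.uhi d

/-- Upper bound on `v_k`: the elementwise maximum of the images of the two bounds on `u`. -/
def vhi (d : Fin nd → ℝ) : Fin m → ℝ := P.Ψ.eval P.ulo d ⊔ P.Ψ.eval P.uhi d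

/-- The constraint function: `g ≤ 0` is the box constraint `vlo ≤ v_k ≤ vhi`, `k < n`. For a
diagonal network `Ψ` with continuous activations it says that `ulo ≤ Ψ⁻¹(v_k; d) ≤ uhi` for all
`k < n`; see `constr_nonpos_iff`. -/
def constr (V : Fin n → Fin m → ℝ) (p : Param m nd) : Mult n m :=
  Sum.elim (fun ki => V ki.1 ki.2 - P.vhi p.2.1 ki.2) (fun ki => P.vlo p.2.1 ki.2 - V ki.1 ki.2)

/-- The Lagrangian `L = f + λᵀ g`. -/
def lagrangian (V : Fin n → Fin m → ℝ) (lam : Mult n m) (p : Param m nd) : ℝ :=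
  P.cost V p + lam ⬝ᵥ P.constr V p

/-- The Fischer–Burmeister map `F(V, λ; p) = (∂L/∂V, φ(λ, -g))`. -/
def F (w : (Fin n → Fin m → ℝ) × Mult n m) (p : Param m nd) :
    (Fin n → Fin m → ℝ) × Mult n m :=
  (fun k i => fderiv ℝ (fun V => P.lagrangian V w.2 p) w.1 (Pi.single k (Pi.single i 1)),
   fun j => fischerBurmeister (w.2 j) (-(P.constr w.1 p j)))

/-- The parameters for which `B_Δ(d)` is nonsingular. -/
def regular : Set (Param m nd) := {p | IsUnit (P.BΔ p.2.1)}

end OCP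

/-! ## The constraint function describes the input constraints -/

theorem BNN.eval_coord {m p : ℕ} (N : BNN m p) (hd : N.IsDiagonal) (hc : N.IsOfClass 0)
    (η : Fin p → ℝ) (j : Fin m) :
    ∃ ψ : ℝ → ℝ, (StrictMono ψ ∨ StrictAnti ψ) ∧ ∀ ξ, N.eval ξ η j = ψ (ξ j) := by
  obtain ⟨ls⟩ := N
  unfold BNN.eval
  induction ls with
  | nil => exact ⟨id, Or.inl strictMono_id, fun ξ => rfl⟩
  | cons l ls ih =>
    obtain ⟨ψ, hψ, he⟩ := ih (fun l' h => hd l' (List.mem_cons_of_mem _ h))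
      (fun l' h => hc l' (List.mem_cons_of_mem _ h))
    have hdl : (l.Ω η).IsDiag := hd l (by simp) η
    have hΩ : l.Ω η = Matrix.diagonal (fun i => l.Ω η i i) := hdl.diagonal_diag.symm
    have hne : l.Ω η j j ≠ 0 := by
      have h := (Matrix.isUnit_iff_isUnit_det _).1 (l.nonsingular η)
      rw [hΩ, Matrix.det_diagonal, isUnit_iff_ne_zero, Finset.prod_ne_zero_iff] at h
      exact h j (Finset.mem_univ _)
    have hval : ∀ ξ, l.eval ξ η j = l.φ j (l.Ω η j j * ξ j + l.β η j) η := by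
      intro ξ
      unfold BNNLayer.eval
      rw [Pi.add_apply, hΩ, Matrix.mulVec_diagonal, Matrix.diagonal_apply_eq]
    have hcl : Continuous (fun t => l.φ j (l.Ω η j j * t + l.β η j) η) := by
      have := ((hc l (by simp)).1 j).continuous
      exact this.comp (by fun_prop : Continuous fun t : ℝ => (l.Ω η j j * t + l.β η j, η))
    have hinj : Function.Injective (fun t => l.φ j (l.Ω η j j * t + l.β η j) η) := by
      intro s t hst
      have := (l.bijective j η).1 hst
      exact mul_left_cancel₀ hne (add_right_cancel this)
    refine ⟨ψ ∘ (fun t => l.φ j (l.Ω η j j * t + l.β η j) η), ?_, fun ξ => ?_⟩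
    · rcases hψ with h | h <;> rcases hcl.strictMono_of_inj hinj with h' | h'
      · exact Or.inl (h.comp h')
      · exact Or.inr (h.comp_strictAnti h')
      · exact Or.inr (h.comp_strictMono h')
      · exact Or.inl (h.comp h')
    · simp only [List.foldl_cons, Function.comp_apply]
      rw [he, hval]

theorem OCP.constr_nonpos_iff {n m nd nz : ℕ} (P : OCP n m nd nz) (hd : P.Ψ.IsDiagonal)
    (hc : P.Ψ.IsOfClass 0) (hu : ∀ i, P.ulo i < P.uhi i) (V : Fin n → Fin m → ℝ)
    (p : Param m nd) :
    P.constr V p ≤ 0 ↔ ∀ k, P.Ψ.inv (V k) p.2.1 ∈ Set.Icc P.ulo P.uhi := by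
  have hinv : ∀ k, P.Ψ.eval (P.Ψ.inv (V k) p.2.1) p.2.1 = V k := fun k =>
    (Equiv.ofBijective _ (P.Ψ.eval_bijective p.2.1)).apply_symm_apply (V k)
  have key : ∀ k i, (P.vlo p.2.1 i ≤ V k i ∧ V k i ≤ P.vhi p.2.1 i) ↔
      (P.ulo i ≤ P.Ψ.inv (V k) p.2.1 i ∧ P.Ψ.inv (V k) p.2.1 i ≤ P.uhi i) := by
    intro k i
    obtain ⟨ψ, hψ, he⟩ := P.Ψ.eval_coord hd hc p.2.1 i
    have h1 : V k i = ψ (P.Ψ.inv (V k) p.2.1 i) := by rw [← he, hinv]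
    have hi := hu i
    simp only [OCP.vlo, OCP.vhi, Pi.inf_apply, Pi.sup_apply, he]
    rw [h1]
    rcases hψ with h | h
    · rw [min_eq_left (h hi).le, max_eq_right (h hi).le, h.le_iff_le, h.le_iff_le]
    · rw [min_eq_right (h hi).le, max_eq_left (h hi).le, h.le_iff_ge, h.le_iff_ge, and_comm]
  constructor
  · intro h k
    have := fun i => (key k i).1 ⟨by simpa [OCP.constr] using h (Sum.inr (k, i)),
      by simpa [OCP.constr] using h (Sum.inl (k, i))⟩
    exact ⟨fun i => (this i).1, fun i => (this i).2⟩
  · rintro h (⟨k, i⟩ | ⟨k, i⟩)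
    · simpa [OCP.constr] using ((key k i).2 ⟨(h k).1 i, (h k).2 i⟩).2
    · simpa [OCP.constr] using ((key k i).2 ⟨(h k).1 i, (h k).2 i⟩).1

end HW

end

/-!
For a fixed parameter the cost is strongly convex in the inputs `V`: the tracking error is affine
in `V`, its linear part is injective because `B_Δ` is nonsingular (`trackingForm_pos`), and the
remaining terms are convex, the output cost because a partially input convex network is convex in
each output and the output cost is monotone (`OCP.convexOn_costRest`). By
`OCP.two_mul_trackingForm_le` the gradient is strongly monotone.

A zero of the Fischer–Burmeister function is a complementary pair, so `F = 0` is the system of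
Karush–Kuhn–Tucker conditions of minimising the cost over a box. Eliminating the multipliers turns
it into a variational inequality on the box (`OCP.IsStationary`). A minimiser solves it, strong
monotonicity makes its solution unique, and the multipliers are recovered as the positive and the
negative part of the gradient, uniquely since the lower bounds lie strictly below the upper ones.

For the dependence on the parameters, the moving box is first mapped affinely onto the unit cube:
comparing projections onto two different boxes would only give Hölder continuity of order `1/2`,
whereas over a fixed set strong monotonicity gives a Lipschitz estimate at once
(`locallyLipschitz_of_variationalInequality`). That estimate needs a gradient which is jointly
locally Lipschitz in inputs and parameters. The parameters enter only through finitely many real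
coefficients (`Coef`), the cost is jointly `C²` in inputs and coefficients, so its gradient is
`C¹`, and the coefficients are locally Lipschitz in the parameters on the regular set.
Finally `Ψ⁻¹` is locally Lipschitz in both variables by the inverse function theorem
(`locallyLipschitz_inv`).
-/

noncomputable section

namespace HW

open Filter Topology
open scoped NNReal

/-! ### Locally Lipschitz maps -/

theorem locallyLipschitz_pi {X ι : Type*} [PseudoEMetricSpace X] [Fintype ι] {E : ι → Type*}
    [∀ i, PseudoEMetricSpace (E i)] {f : X → ∀ i, E i}
    (h : ∀ i, LocallyLipschitz fun x => f x i) : LocallyLipschitz f := by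
  intro x
  choose K t ht hK using fun i => h i x
  refine ⟨∑ i, K i, ⋂ i, t i, iInter_mem.2 ht, fun y hy z hz => ?_⟩
  rw [edist_pi_le_iff]
  intro i
  refine (hK i (mem_iInter.1 hy i) (mem_iInter.1 hz i)).trans ?_
  gcongr
  exact Finset.single_le_sum (f := K) (fun _ _ => zero_le) (Finset.mem_univ i)

/-- A jointly locally Lipschitz map is, near a given parameter, Lipschitz in the parameter
uniformly over a compact set of the other variable. -/
theorem exists_lipschitzOnWith_of_isCompact {X Y Z : Type*} [PseudoEMetricSpace X]
    [PseudoEMetricSpace Y] [PseudoEMetricSpace Z] {f : Y × X → Z} (hf : LocallyLipschitz f)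
    {s : Set Y} (hs : IsCompact s) (x₀ : X) :
    ∃ C : ℝ≥0, ∃ U ∈ 𝓝 x₀, ∀ y ∈ s, LipschitzOnWith C (fun x => f (y, x)) U := by
  refine hs.induction_on (p := fun s => ∃ C : ℝ≥0, ∃ U ∈ 𝓝 x₀, ∀ y ∈ s,
    LipschitzOnWith C (fun x => f (y, x)) U) ⟨0, univ, univ_mem, by simp⟩ ?_ ?_ ?_
  · rintro s t hst ⟨C, U, hU, h⟩
    exact ⟨C, U, hU, fun y hy => h y (hst hy)⟩
  · rintro s t ⟨C, U, hU, h⟩ ⟨C', U', hU', h'⟩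
    refine ⟨max C C', U ∩ U', inter_mem hU hU', ?_⟩
    rintro y (hy | hy)
    · exact ((h y hy).mono inter_subset_left).weaken (le_max_left _ _)
    · exact ((h' y hy).mono inter_subset_right).weaken (le_max_right _ _)
  · intro y _
    obtain ⟨C, t, ht, h⟩ := hf (y, x₀)
    rw [nhds_prod_eq, mem_prod_iff] at ht
    obtain ⟨V, hV, U, hU, hVU⟩ := ht
    refine ⟨V, mem_nhdsWithin_of_mem_nhds hV, C, U, hU, fun y' hy' x hx x' hx' => ?_⟩
    have h2 := h (hVU (mk_mem_prod hy' hx)) (hVU (mk_mem_prod hy' hx'))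
    simpa [Prod.edist_eq] using h2

/-- If `f` is continuously differentiable in `(x, d)` and, for each `d`, bijective in `x` with
bijective derivative, then its inverse in `x` is locally Lipschitz in both variables. -/
theorem locallyLipschitz_inv {E D : Type*} [NormedAddCommGroup E] [NormedSpace ℝ E]
    [FiniteDimensional ℝ E] [NormedAddCommGroup D] [NormedSpace ℝ D] [FiniteDimensional ℝ D]
    {f g : E → D → E} (hf : ContDiff ℝ 1 fun q : E × D => f q.1 q.2)
    (hd : ∀ d x, Function.Bijective (fderiv ℝ (fun y => f y d) x))
    (hgf : ∀ x d, g (f x d) d = x) (hfg : ∀ y d, f (g y d) d = y) :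
    LocallyLipschitz fun q : E × D => g q.1 q.2 := by
  have := FiniteDimensional.complete ℝ (E × D)
  rintro ⟨y, d⟩
  set x := g y d with hx
  -- the inverse function theorem is applied to `(x, d) ↦ (f x d, d)`
  have h1 : HasStrictFDerivAt (fun q : E × D => (f q.1 q.2, q.2))
      ((fderiv ℝ (fun q : E × D => f q.1 q.2) (x, d)).prod (ContinuousLinearMap.snd ℝ E D))
      (x, d) :=
    (hf.contDiffAt.hasStrictFDerivAt one_ne_zero).prodMk hasStrictFDerivAt_snd
  set T := (fderiv ℝ (fun q : E × D => f q.1 q.2) (x, d)).prod (ContinuousLinearMap.snd ℝ E D)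
  have hpart : ∀ e, fderiv ℝ (fun y => f y d) x e
      = fderiv ℝ (fun q : E × D => f q.1 q.2) (x, d) (e, 0) := by
    intro e
    have h2 := HasFDerivAt.comp (g := fun q : E × D => f q.1 q.2) (f := fun y => (y, d)) x
      (hf.differentiable one_ne_zero (x, d)).hasFDerivAt
      ((hasFDerivAt_id x).prodMk (hasFDerivAt_const d x))
    rw [show (fun y => f y d) = (fun q : E × D => f q.1 q.2) ∘ fun y => (y, d) from rfl, h2.fderiv]
    simp
  have hT : Function.Injective T := by
    rw [injective_iff_map_eq_zero]
    rintro ⟨e, e'⟩ he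
    have he' : e' = 0 := congrArg Prod.snd he
    subst he'
    have h3 : fderiv ℝ (fun y => f y d) x e = 0 := by
      rw [hpart]; exact congrArg Prod.fst he
    rw [(injective_iff_map_eq_zero _).1 (hd d x).1 e h3]
    rfl
  let T' : (E × D) ≃L[ℝ] (E × D) :=
    (LinearEquiv.ofInjectiveEndo (T : (E × D) →ₗ[ℝ] (E × D)) hT).toContinuousLinearEquiv
  have h1' : HasStrictFDerivAt (fun q : E × D => (f q.1 q.2, q.2)) (T' : (E × D) →L[ℝ] (E × D))
      (x, d) := by
    convert h1
    ext <;> rfl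
  have h4 := h1'.to_local_left_inverse (g := fun q : E × D => (g q.1 q.2, q.2))
    (Eventually.of_forall fun q => by simp [hgf])
  have h5 : (f x d, d) = (y, d) := by rw [hx, hfg]
  simp only [h5] at h4
  obtain ⟨K, s, hs, hK⟩ := h4.exists_lipschitzOnWith
  refine ⟨K, s, hs, fun p hp q hq => le_trans ?_ (hK hp hq)⟩
  exact le_max_left _ _

/-! ### Convexity and monotone derivatives -/

theorem _root_.ConvexOn.fderiv_monotone {E : Type*} [NormedAddCommGroup E] [NormedSpace ℝ E]
    {f : E → ℝ} (hf : ConvexOn ℝ univ f) (hd : Differentiable ℝ f) (x y : E) :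
    0 ≤ (fderiv ℝ f x - fderiv ℝ f y) (x - y) := by
  have hg : ConvexOn ℝ univ (f ∘ AffineMap.lineMap (k := ℝ) y x) := by
    simpa using hf.comp_affineMap (AffineMap.lineMap (k := ℝ) y x)
  have hderiv : ∀ t : ℝ, HasDerivAt (f ∘ AffineMap.lineMap (k := ℝ) y x)
      (fderiv ℝ f (AffineMap.lineMap (k := ℝ) y x t) (x - y)) t := fun t =>
    (hd _).hasFDerivAt.comp_hasDerivAt t AffineMap.hasDerivAt_lineMap
  have h := hg.monotoneOn_deriv (fun t _ => (hderiv t).differentiableAt) (mem_univ 0) (mem_univ 1)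
    zero_le_one
  rw [(hderiv 0).deriv, (hderiv 1).deriv] at h
  simpa using h

/-- The increment of the gradient of `f` from `y` to `x`, tested on `x - y`, when `f` is quadratic on
the line through the two points. -/
theorem fderiv_sub_apply_of_quadratic {E : Type*} [NormedAddCommGroup E] [NormedSpace ℝ E]
    {f : E → ℝ} (hd : Differentiable ℝ f) (x y : E) {a b c : ℝ}
    (h : ∀ t : ℝ, f (y + t • (x - y)) = a + t * b + t ^ 2 * c) :
    (fderiv ℝ f x - fderiv ℝ f y) (x - y) = 2 * c := by
  have h1 : ∀ t : ℝ, HasDerivAt (fun t : ℝ => f (y + t • (x - y)))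
      (fderiv ℝ f (y + t • (x - y)) (x - y)) t := fun t =>
    (hd _).hasFDerivAt.comp_hasDerivAt t
      (by simpa using ((hasDerivAt_id t).smul_const (x - y)).const_add y)
  have h2 : ∀ t : ℝ, HasDerivAt (fun t : ℝ => f (y + t • (x - y))) (b + 2 * t * c) t := by
    intro t
    simp_rw [h]
    have h3 : HasDerivAt (fun t : ℝ => a + t * b + t ^ 2 * c)
        (1 * b + ((2 : ℕ) : ℝ) * t ^ (2 - 1) * c) t :=
      (((hasDerivAt_id' t).mul_const b).const_add a).add ((hasDerivAt_pow 2 t).mul_const c)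
    simpa using h3
  have h3 := (h1 1).unique (h2 1)
  have h4 := (h1 0).unique (h2 0)
  simp only [one_smul, add_sub_cancel, zero_smul, add_zero] at h3 h4
  rw [_root_.sub_apply, h3, h4]
  ring

/-! ### Strongly monotone variational inequalities -/

/-- Near a parameter `p₀`, a form `q (·, p)` that is homogeneous of degree two, positive definite
at `p₀` and jointly continuous is bounded below by a fixed multiple of the squared norm. -/
theorem exists_quadratic_lower_bound {E X : Type*} [NormedAddCommGroup E] [NormedSpace ℝ E]
    [ProperSpace E] [TopologicalSpace X] {q : E × X → ℝ} (hq : Continuous q)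
    (hhom : ∀ (r : ℝ) W p, q (r • W, p) = r ^ 2 * q (W, p)) (p₀ : X)
    (hpos : ∀ W, W ≠ 0 → 0 < q (W, p₀)) :
    ∃ μ > 0, ∀ᶠ p in 𝓝 p₀, ∀ W, μ * ‖W‖ ^ 2 ≤ q (W, p) := by
  have hS : IsCompact (Metric.sphere (0 : E) 1) := isCompact_sphere _ _
  obtain ⟨μ, hμ, h⟩ := hS.exists_forall_le' (f := fun W => q (W, p₀)) (a := 0)
    (by fun_prop) (fun W hW => hpos W (ne_zero_of_mem_unit_sphere ⟨W, hW⟩))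
  refine ⟨μ / 2, by positivity, ?_⟩
  have h1 : ∀ᶠ p in 𝓝 p₀, ∀ W ∈ Metric.sphere (0 : E) 1, μ / 2 < q (W, p) := by
    refine hS.eventually_forall_of_forall_eventually fun W hW => ?_
    have h2 : Continuous fun z : X × E => q (z.2, z.1) := by fun_prop
    exact h2.continuousAt.eventually_const_lt (by linarith [h W hW])
  filter_upwards [h1] with p hp W
  rcases eq_or_ne W 0 with rfl | hW
  · have := hhom 0 0 p
    rw [smul_zero] at this
    rw [this]
    simp
  · have hn : ‖W‖ ≠ 0 := norm_ne_zero_iff.2 hW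
    have h3 := hp (‖W‖⁻¹ • W) (by simp [norm_smul, hn])
    rw [hhom] at h3
    have h4 : 0 < ‖W‖ ^ 2 := by positivity
    rw [inv_pow, inv_mul_eq_div, lt_div_iff₀ h4] at h3
    exact h3.le

/-- The solution of a strongly monotone variational inequality over a fixed compact set depends on
the parameter in a locally Lipschitz way. For parameters `p, p'` with solutions `τ, τ'` the two
inequalities give `μ ‖τ - τ'‖² ≤ (H(τ', p') - H(τ', p)) (τ - τ') ≤ C d(p, p') ‖τ - τ'‖`. -/
theorem locallyLipschitz_of_variationalInequality {E X : Type*} [NormedAddCommGroup E]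
    [NormedSpace ℝ E] [ProperSpace E] [PseudoMetricSpace X] {s : Set E} (hs : IsCompact s)
    {H : E × X → (E →L[ℝ] ℝ)} (hH : LocallyLipschitz H) {q : E × X → ℝ} (hq : Continuous q)
    (hhom : ∀ (r : ℝ) W p, q (r • W, p) = r ^ 2 * q (W, p)) (hpos : ∀ W p, W ≠ 0 → 0 < q (W, p))
    (hmono : ∀ t t' p, q (t - t', p) ≤ (H (t, p) - H (t', p)) (t - t'))
    {τ : X → E} (hτ : ∀ p, τ p ∈ s) (hvi : ∀ p, ∀ t ∈ s, 0 ≤ H (τ p, p) (t - τ p)) :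
    LocallyLipschitz τ := by
  intro p₀
  obtain ⟨μ, hμ, hlow⟩ := exists_quadratic_lower_bound hq hhom p₀ fun W => hpos W p₀
  obtain ⟨C, U, hU, hC⟩ := exists_lipschitzOnWith_of_isCompact hH hs p₀
  refine ⟨C / μ.toNNReal, _, inter_mem hU hlow, LipschitzOnWith.of_dist_le_mul ?_⟩
  rintro p ⟨hpU, hp⟩ p' ⟨hpU', -⟩
  have h1 : μ * ‖τ p - τ p'‖ ^ 2 ≤ (H (τ p, p) - H (τ p', p)) (τ p - τ p') :=
    (hp _).trans (hmono _ _ _)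
  have h2 := hvi p _ (hτ p')
  have h3 := hvi p' _ (hτ p)
  have h4 : (H (τ p', p') - H (τ p', p)) (τ p - τ p') ≤ C * dist p p' * ‖τ p - τ p'‖ := by
    refine (le_abs_self _).trans ((Real.norm_eq_abs _).symm.le.trans <|
      (ContinuousLinearMap.le_opNorm _ _).trans ?_)
    gcongr
    rw [← dist_eq_norm, dist_comm p]
    exact (hC _ (hτ p')).dist_le_mul _ hpU' _ hpU
  have h5 : μ * ‖τ p - τ p'‖ ^ 2 ≤ C * dist p p' * ‖τ p - τ p'‖ := by
    refine le_trans ?_ h4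
    refine h1.trans ?_
    rw [← neg_sub (τ p) (τ p'), map_neg] at h2
    simp only [_root_.sub_apply]
    linarith
  rw [dist_eq_norm, NNReal.coe_div, Real.coe_toNNReal μ hμ.le, div_mul_eq_mul_div, le_div_iff₀ hμ]
  rcases (norm_nonneg (τ p - τ p')).eq_or_lt with h0 | h0
  · rw [← h0, zero_mul]; positivity
  · refine le_of_mul_le_mul_right ?_ h0
    linarith

/-! ### Smoothness and convexity of the networks -/

theorem BNN.contDiff_eval {m p : ℕ} {r : WithTop ℕ∞} {N : BNN m p} (hN : N.IsOfClass r)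
    {E : Type*} [NormedAddCommGroup E] [NormedSpace ℝ E] {f : E → Fin m → ℝ} {g : E → Fin p → ℝ}
    (hf : ContDiff ℝ r f) (hg : ContDiff ℝ r g) : ContDiff ℝ r fun e => N.eval (f e) (g e) := by
  obtain ⟨ls⟩ := N
  unfold BNN.eval
  induction ls generalizing f with
  | nil => exact hf
  | cons l ls ih =>
    refine ih (f := fun e => l.eval (f e) (g e)) ?_ fun l' h => hN l' (List.mem_cons_of_mem _ h)
    obtain ⟨h1, h2, h3⟩ := hN l (by simp)
    have h2' := fun i j => (h2 i j).comp hg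
    have h3' := h3.comp hg
    have hf' := fun i => contDiff_pi.1 hf i
    refine contDiff_pi.2 fun j => ?_
    refine (h1 j).comp (ContDiff.prodMk ?_ hg)
    simp only [Pi.add_apply, mulVec, dotProduct]
    exact (ContDiff.sum fun i _ => (h2' j i).mul (hf' i)).add (contDiff_pi.1 h3' j)

theorem contDiff_softplus {r : WithTop ℕ∞} : ContDiff ℝ r softplus :=
  (contDiff_const.add Real.contDiff_exp).log fun t => by positivity

theorem softplus_nonneg (t : ℝ) : 0 ≤ softplus t :=
  Real.log_nonneg (by linarith [Real.exp_pos t])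

theorem contDiff_mulVec {E a b : Type*} [Fintype a] [Fintype b] [NormedAddCommGroup E]
    [NormedSpace ℝ E] {r : WithTop ℕ∞} {M : E → Matrix a b ℝ} {f : E → b → ℝ}
    (hM : ∀ i j, ContDiff ℝ r fun e => M e i j) (hf : ContDiff ℝ r f) :
    ContDiff ℝ r fun e => M e *ᵥ f e :=
  contDiff_pi.2 fun i => ContDiff.sum fun j _ => (hM i j).mul (contDiff_pi.1 hf j)

theorem PICNNLayer.contDiff_nextζ {r : WithTop ℕ∞} {q a b a' b' : ℕ}
    (l : PICNNLayer r q a b a' b') {E : Type*} [NormedAddCommGroup E] [NormedSpace ℝ E]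
    {ξ : E → Fin q → ℝ} {ζ : E → Fin a → ℝ} {η : E → Fin b → ℝ} (hξ : ContDiff ℝ r ξ)
    (hζ : ContDiff ℝ r ζ) (hη : ContDiff ℝ r η) :
    ContDiff ℝ r fun e => l.nextζ (ξ e) (ζ e) (η e) := by
  have haff : ∀ {c : ℕ} (W : Matrix (Fin c) (Fin b) ℝ) (w : Fin c → ℝ),
      ContDiff ℝ r fun e => W *ᵥ η e + w := fun W w =>
    (contDiff_mulVec (M := fun _ => W) (fun _ _ => contDiff_const) hη).add contDiff_const
  refine l.φζ_contDiff.comp (ContDiff.add (ContDiff.add ?_ ?_) (haff _ _))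
  · refine contDiff_mulVec (M := fun _ => l.Wζ) (fun _ _ => contDiff_const)
      (contDiff_pi.2 fun i => ?_)
    exact (contDiff_pi.1 hζ i).mul (contDiff_softplus.comp (contDiff_pi.1 (haff _ _) i))
  · refine contDiff_mulVec (M := fun _ => l.Wξ) (fun _ _ => contDiff_const)
      (contDiff_pi.2 fun i => ?_)
    exact (contDiff_pi.1 hξ i).mul (contDiff_pi.1 (haff _ _) i)

theorem PICNNChain.contDiff_eval {r : WithTop ℕ∞} {q c : ℕ} {E : Type*} [NormedAddCommGroup E]
    [NormedSpace ℝ E] {ξ : E → Fin q → ℝ} (hξ : ContDiff ℝ r ξ) {a b : ℕ}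
    (N : PICNNChain r q c a b) {ζ : E → Fin a → ℝ} {η : E → Fin b → ℝ}
    (hζ : ContDiff ℝ r ζ) (hη : ContDiff ℝ r η) :
    ContDiff ℝ r fun e => N.eval (ξ e) (ζ e) (η e) := by
  induction N with
  | output b => exact hζ
  | layer l rest ih =>
    refine ih (l.contDiff_nextζ hξ hζ hη) (l.φη_contDiff.comp ?_)
    exact (contDiff_mulVec (M := fun _ => l.Wη) (fun _ _ => contDiff_const) hη).add contDiff_const

/-- The weights multiplying `ζ` are nonnegative, those multiplying the network input `ξ` are
arbitrary but enter linearly; so the argument of the activation is convex. -/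
theorem PICNNLayer.convexOn_nextζ {r : WithTop ℕ∞} {q a b a' b' : ℕ}
    (l : PICNNLayer r q a b a' b') {ζ : (Fin q → ℝ) → Fin a → ℝ} (hζ : ConvexOn ℝ univ ζ)
    (η : Fin b → ℝ) : ConvexOn ℝ univ fun ξ => l.nextζ ξ (ζ ξ) η := by
  refine ⟨convex_univ, fun x _ y _ s t hs ht hst => ?_⟩
  refine le_trans (l.φζ_mono ?_) (l.φζ_convex.2 (mem_univ _) (mem_univ _) hs ht hst)
  intro i
  have h1 : ∀ j, ζ (s • x + t • y) j ≤ s * ζ x j + t * ζ y j := fun j => by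
    simpa using hζ.2 (mem_univ x) (mem_univ y) hs ht hst j
  have h2 : (l.Wζ *ᵥ fun j => ζ (s • x + t • y) j * softplus ((l.Wζη *ᵥ η + l.bζη) j)) i ≤
      s * (l.Wζ *ᵥ fun j => ζ x j * softplus ((l.Wζη *ᵥ η + l.bζη) j)) i +
      t * (l.Wζ *ᵥ fun j => ζ y j * softplus ((l.Wζη *ᵥ η + l.bζη) j)) i := by
    simp only [mulVec, dotProduct, Finset.mul_sum, ← Finset.sum_add_distrib]
    refine Finset.sum_le_sum fun j _ => ?_
    have := mul_le_mul_of_nonneg_left (mul_le_mul_of_nonneg_right (h1 j)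
      (softplus_nonneg ((l.Wζη *ᵥ η + l.bζη) j))) (l.Wζ_nonneg i j)
    linarith
  have h3 : (l.Wξ *ᵥ fun j => (s • x + t • y) j * (l.Wξη *ᵥ η + l.bξη) j) i =
      s * (l.Wξ *ᵥ fun j => x j * (l.Wξη *ᵥ η + l.bξη) j) i +
      t * (l.Wξ *ᵥ fun j => y j * (l.Wξη *ᵥ η + l.bξη) j) i := by
    simp only [mulVec, dotProduct, Finset.mul_sum, ← Finset.sum_add_distrib]
    refine Finset.sum_congr rfl fun j _ => ?_
    simp only [Pi.add_apply, Pi.smul_apply, smul_eq_mul]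
    ring
  have h4 : (l.Wηη *ᵥ η + l.bηη) i =
      s * (l.Wηη *ᵥ η + l.bηη) i + t * (l.Wηη *ᵥ η + l.bηη) i := by
    rw [← add_mul, hst, one_mul]
  change _ + _ + (l.Wηη *ᵥ η + l.bηη) i ≤ s * (_ + _ + (l.Wηη *ᵥ η + l.bηη) i)
    + t * (_ + _ + (l.Wηη *ᵥ η + l.bηη) i)
  linarith

theorem PICNNChain.convexOn_eval {r : WithTop ℕ∞} {q c a b : ℕ} (N : PICNNChain r q c a b)
    {ζ : (Fin q → ℝ) → Fin a → ℝ} (hζ : ConvexOn ℝ univ ζ) (η : Fin b → ℝ) :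
    ConvexOn ℝ univ fun ξ => N.eval ξ (ζ ξ) η := by
  induction N with
  | output b => exact hζ
  | layer l rest ih => exact ih (l.convexOn_nextζ hζ η) _

theorem PICNN.convexOn_eval {r : WithTop ℕ∞} {q p c : ℕ} (N : PICNN r q p c) (η : Fin p → ℝ) :
    ConvexOn ℝ univ fun ξ => PICNN.eval N ξ η :=
  PICNNChain.convexOn_eval N (convexOn_id convex_univ) η

theorem _root_.ConvexOn.comp_of_map_combo {E F β : Type*} [AddCommGroup E] [Module ℝ E]
    [AddCommGroup F] [Module ℝ F] [AddCommGroup β] [PartialOrder β] [Module ℝ β] {f : F → β}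
    (hf : ConvexOn ℝ univ f) {g : E → F}
    (hg : ∀ x y (s t : ℝ), s + t = 1 → g (s • x + t • y) = s • g x + t • g y) :
    ConvexOn ℝ univ (f ∘ g) := by
  refine ⟨convex_univ, fun x _ y _ s t hs ht hst => ?_⟩
  simp only [Function.comp_apply, hg x y s t hst]
  exact hf.2 (mem_univ _) (mem_univ _) hs ht hst

/-! ### The sampled system matrices -/

section Exp

attribute [local instance] Matrix.linftyOpNormedRing Matrix.linftyOpNormedAlgebra

/-- The operator norm only serves to make the matrices a Banach algebra; statement and use are
entrywise, so no norm on matrices has to be fixed. -/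
theorem contDiff_matrix_exp_apply {m : ℕ} {E : Type*} [NormedAddCommGroup E] [NormedSpace ℝ E]
    {M : E → Matrix (Fin m) (Fin m) ℝ} (hM : ∀ i j, ContDiff ℝ 1 fun e => M e i j)
    (i j : Fin m) : ContDiff ℝ 1 fun e => NormedSpace.exp (M e) i j := by
  have hexp : ContDiff ℝ 1 (NormedSpace.exp : Matrix (Fin m) (Fin m) ℝ → _) :=
    contDiff_iff_contDiffAt.2 fun x => (NormedSpace.exp_analytic (𝕂 := ℝ) x).contDiffAt
  let L : (Fin m → Fin m → ℝ) →L[ℝ] Matrix (Fin m) (Fin m) ℝ :=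
    LinearMap.toContinuousLinearMap (Matrix.ofLinearEquiv ℝ).toLinearMap
  let R : Matrix (Fin m) (Fin m) ℝ →L[ℝ] ℝ :=
    LinearMap.toContinuousLinearMap (Matrix.entryLinearMap ℝ ℝ i j)
  have h : ContDiff ℝ 1 fun e => (fun i j => M e i j : Fin m → Fin m → ℝ) :=
    contDiff_pi.2 fun i => contDiff_pi.2 fun j => hM i j
  exact R.contDiff.comp (hexp.comp (L.contDiff.comp h))

end Exp

theorem locallyLipschitz_intervalIntegral {X : Type*} [PseudoMetricSpace X] {f : ℝ × X → ℝ}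
    (hf : LocallyLipschitz f) (a b : ℝ) : LocallyLipschitz fun x => ∫ τ in a..b, f (τ, x) := by
  intro x₀
  obtain ⟨C, U, hU, hC⟩ :=
    exists_lipschitzOnWith_of_isCompact hf (isCompact_uIcc (a := a) (b := b)) x₀
  refine ⟨C * ‖b - a‖₊, U, hU, LipschitzOnWith.of_dist_le_mul fun x hx y hy => ?_⟩
  have hint : ∀ x, IntervalIntegrable (fun τ => f (τ, x)) MeasureTheory.volume a b := fun x =>
    (hf.continuous.comp (by fun_prop : Continuous fun τ : ℝ => (τ, x))).intervalIntegrable _ _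
  rw [dist_eq_norm, ← intervalIntegral.integral_sub (hint x) (hint y)]
  refine (intervalIntegral.norm_integral_le_of_norm_le_const (C := C * dist x y)
    fun τ hτ => ?_).trans_eq ?_
  · rw [← dist_eq_norm]
    exact (hC τ (uIoc_subset_uIcc hτ)).dist_le_mul _ hx _ hy
  · rw [NNReal.coe_mul, coe_nnnorm, Real.norm_eq_abs]; ring

variable {n m nd nz : ℕ}

theorem LocallyLipschitz.real_mul {X : Type*} [PseudoEMetricSpace X] {f g : X → ℝ}
    (hf : LocallyLipschitz f) (hg : LocallyLipschitz g) : LocallyLipschitz fun x => f x * g x :=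
  (contDiff_mul (𝕜 := ℝ) (𝔸 := ℝ) (n := 1)).locallyLipschitz.comp (hf.prodMk hg)

theorem LocallyLipschitz.real_sum {X ι : Type*} [PseudoEMetricSpace X] [Fintype ι] {f : X → ι → ℝ}
    (hf : ∀ i, LocallyLipschitz fun x => f x i) : LocallyLipschitz fun x => ∑ i, f x i :=
  (ContDiff.sum fun i _ => contDiff_apply ℝ ℝ i :
    ContDiff ℝ 1 fun v : ι → ℝ => ∑ i, v i).locallyLipschitz.comp (locallyLipschitz_pi hf)

namespace OCP

variable (P : OCP n m nd nz)

theorem locallyLipschitz_AΔ (hA : ∀ i j, LocallyLipschitz fun d => P.A d i j) (i j : Fin m) :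
    LocallyLipschitz fun d => P.AΔ d i j := by
  have h := contDiff_matrix_exp_apply (E := Fin m → Fin m → ℝ)
    (M := fun M => P.Δ • Matrix.of M)
    (fun i j => by simp only [Matrix.smul_apply, of_apply]; fun_prop) i j
  exact h.locallyLipschitz.comp (locallyLipschitz_pi fun i => locallyLipschitz_pi fun j => hA i j)

theorem locallyLipschitz_intExp (hA : ∀ i j, LocallyLipschitz fun d => P.A d i j) (i j : Fin m) :
    LocallyLipschitz fun d => P.intExp d i j := by
  have h := contDiff_matrix_exp_apply (E := ℝ × (Fin m → Fin m → ℝ))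
    (M := fun q => (P.Δ - q.1) • Matrix.of q.2)
    (fun i j => by simp only [Matrix.smul_apply, of_apply]; fun_prop) i j
  exact (locallyLipschitz_intervalIntegral h.locallyLipschitz 0 P.Δ).comp
    (locallyLipschitz_pi fun i => locallyLipschitz_pi fun j => hA i j)

theorem locallyLipschitz_BΔ (hA : ∀ i j, LocallyLipschitz fun d => P.A d i j)
    (hB : ∀ i j, LocallyLipschitz fun d => P.B d i j) (i j : Fin m) :
    LocallyLipschitz fun d => P.BΔ d i j :=
  LocallyLipschitz.real_sum fun l =>
    LocallyLipschitz.real_mul (P.locallyLipschitz_intExp hA i l) (hB l j)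

theorem locallyLipschitz_cΔ (hA : ∀ i j, LocallyLipschitz fun d => P.A d i j)
    (hc : LocallyLipschitz P.c) : LocallyLipschitz P.cΔ :=
  locallyLipschitz_pi fun i => LocallyLipschitz.real_sum fun l =>
    LocallyLipschitz.real_mul (P.locallyLipschitz_intExp hA i l)
      ((LipschitzWith.eval l).locallyLipschitz.comp hc)

theorem locallyLipschitz_vlo (hΨ : P.Ψ.IsOfClass 2) : LocallyLipschitz P.vlo := by
  have h : ∀ u i, LocallyLipschitz fun d => P.Ψ.eval u d i := fun u i =>
    (contDiff_pi.1 ((P.Ψ.contDiff_eval hΨ contDiff_const contDiff_id).of_le one_le_two)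
      i).locallyLipschitz
  exact locallyLipschitz_pi fun i => (h _ i).min (h _ i)

theorem locallyLipschitz_vhi (hΨ : P.Ψ.IsOfClass 2) : LocallyLipschitz P.vhi := by
  have h : ∀ u i, LocallyLipschitz fun d => P.Ψ.eval u d i := fun u i =>
    (contDiff_pi.1 ((P.Ψ.contDiff_eval hΨ contDiff_const contDiff_id).of_le one_le_two)
      i).locallyLipschitz
  exact locallyLipschitz_pi fun i => (h _ i).max (h _ i)

theorem vlo_lt_vhi (hd : P.Ψ.IsDiagonal) (hΨ : P.Ψ.IsOfClass 2) (hu : ∀ i, P.ulo i < P.uhi i)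
    (d : Fin nd → ℝ) (i : Fin m) : P.vlo d i < P.vhi d i := by
  have hc : P.Ψ.IsOfClass 0 := fun l hl =>
    ⟨fun j => ((hΨ l hl).1 j).of_le zero_le, fun i j => ((hΨ l hl).2.1 i j).of_le zero_le,
      (hΨ l hl).2.2.of_le zero_le⟩
  obtain ⟨ψ, hψ, he⟩ := P.Ψ.eval_coord hd hc d i
  simp only [vlo, vhi, Pi.inf_apply, Pi.sup_apply, he, inf_lt_sup]
  rcases hψ with h | h
  · exact (h (hu i)).ne
  · exact (h (hu i)).ne'

end OCP

/-! ### Trajectories of affine recursions -/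

section Trajectory

variable {n m : ℕ}

/-- The solution of `x_{k+1} = a x_k + b v_k + c` started at `x₀`, with `v_k = 0` for `k ≥ n`. -/
def trajectory (a b : Matrix (Fin m) (Fin m) ℝ) (c x₀ : Fin m → ℝ) (V : Fin n → Fin m → ℝ) :
    ℕ → Fin m → ℝ
  | 0 => x₀
  | k + 1 => a *ᵥ trajectory a b c x₀ V k + b *ᵥ (if h : k < n then V ⟨k, h⟩ else 0) + c

variable (a b : Matrix (Fin m) (Fin m) ℝ) (c x₀ : Fin m → ℝ) (V W : Fin n → Fin m → ℝ)

theorem OCP.state_eq_trajectory {nd nz : ℕ} (P : OCP n m nd nz) (x₀ : Fin m → ℝ)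
    (d : Fin nd → ℝ) (V : Fin n → Fin m → ℝ) (k : ℕ) :
    P.state x₀ d V k = trajectory (P.AΔ d) (P.BΔ d) (P.cΔ d) x₀ V k := by
  induction k with
  | zero => rfl
  | succ k ih => rw [OCP.state, trajectory, ih]

theorem contDiff_trajectory {E : Type*} [NormedAddCommGroup E] [NormedSpace ℝ E]
    {r : WithTop ℕ∞} {a b : E → Matrix (Fin m) (Fin m) ℝ} {c x₀ : E → Fin m → ℝ}
    {V : E → Fin n → Fin m → ℝ} (ha : ∀ i j, ContDiff ℝ r fun e => a e i j)
    (hb : ∀ i j, ContDiff ℝ r fun e => b e i j) (hc : ContDiff ℝ r c) (hx : ContDiff ℝ r x₀)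
    (hV : ContDiff ℝ r V) (k : ℕ) :
    ContDiff ℝ r fun e => trajectory (a e) (b e) (c e) (x₀ e) (V e) k := by
  induction k with
  | zero => exact hx
  | succ k ih =>
    refine ((contDiff_mulVec ha ih).add (contDiff_mulVec hb ?_)).add hc
    by_cases h : k < n
    · simpa only [dif_pos h] using contDiff_pi.1 hV ⟨k, h⟩
    · simpa only [dif_neg h] using contDiff_const

theorem trajectory_add_smul (t : ℝ) (k : ℕ) :
    trajectory a b c x₀ (V + t • W) k
      = trajectory a b c x₀ V k + t • trajectory a b 0 0 W k := by
  induction k with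
  | zero => simp [trajectory]
  | succ k ih =>
    have h : (if h : k < n then (V + t • W) ⟨k, h⟩ else 0)
        = (if h : k < n then V ⟨k, h⟩ else 0) + t • (if h : k < n then W ⟨k, h⟩ else 0) := by
      split_ifs <;> simp
    rw [trajectory, trajectory, trajectory, ih, h]
    simp only [mulVec_add, mulVec_smul, smul_add, add_zero]
    abel

theorem trajectory_combo {s t : ℝ} (hst : s + t = 1) (k : ℕ) :
    trajectory a b c x₀ (s • V + t • W) k
      = s • trajectory a b c x₀ V k + t • trajectory a b c x₀ W k := by
  have h1 : s • V + t • W = V + t • (W - V) := by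
    rw [eq_sub_of_add_eq hst]; module
  have h2 := trajectory_add_smul a b c x₀ V (W - V) 1 k
  rw [one_smul, one_smul, add_sub_cancel] at h2
  rw [h1, trajectory_add_smul, h2, eq_sub_of_add_eq hst]
  module

theorem trajectory_zero_smul (r : ℝ) (k : ℕ) :
    trajectory a b 0 0 (r • W) k = r • trajectory a b 0 0 W k := by
  have h0 : trajectory a b 0 0 (0 : Fin n → Fin m → ℝ) k = 0 := by
    induction k with
    | zero => rfl
    | succ k ih => rw [trajectory, ih]; simp
  have := trajectory_add_smul a b 0 0 0 W r k
  rwa [zero_add, h0, zero_add] at this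

/-- The second-order part `(L W)ᵀ Q (L W)` of the tracking cost, where `L W = (x₁, …, x_n)` is the
response to the inputs `W` from rest. -/
def trackingForm (Q : Matrix (Fin n × Fin m) (Fin n × Fin m) ℝ) : ℝ :=
  (fun ki : Fin n × Fin m => trajectory a b 0 0 W (ki.1 + 1) ki.2) ⬝ᵥ
    (Q *ᵥ fun ki => trajectory a b 0 0 W (ki.1 + 1) ki.2)

theorem trackingForm_smul (Q : Matrix (Fin n × Fin m) (Fin n × Fin m) ℝ) (r : ℝ) :
    trackingForm a b (r • W) Q = r ^ 2 * trackingForm a b W Q := by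
  have h : (fun ki : Fin n × Fin m => trajectory a b 0 0 (r • W) (ki.1 + 1) ki.2)
      = r • fun ki : Fin n × Fin m => trajectory a b 0 0 W (ki.1 + 1) ki.2 := by
    funext ki
    rw [trajectory_zero_smul]
    rfl
  simp only [trackingForm, h, mulVec_smul, smul_dotProduct, dotProduct_smul, smul_eq_mul]
  ring

/-- The form is definite: if the response `(x₁, …, x_n)` from rest vanishes, then `b v_k = 0` for
every `k`. -/
theorem trackingForm_pos {b : Matrix (Fin m) (Fin m) ℝ} (hb : IsUnit b)
    {Q : Matrix (Fin n × Fin m) (Fin n × Fin m) ℝ} (hQ : Q.PosDef)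
    {W : Fin n → Fin m → ℝ} (hW : W ≠ 0) : 0 < trackingForm a b W Q := by
  refine hQ.dotProduct_mulVec_pos fun h => hW ?_
  have hz : ∀ k ≤ n, trajectory a b 0 0 W k = 0 := by
    rintro (_ | k) hk
    · rfl
    · exact funext fun i => congrFun h (⟨k, hk⟩, i)
  funext k
  have h1 := hz (k + 1) k.2
  rw [trajectory, hz k k.2.le, dif_pos k.2] at h1
  simp only [mulVec_zero, zero_add, add_zero] at h1
  exact mulVec_injective_of_isUnit hb (h1.trans (mulVec_zero b).symm)

end Trajectory

/-! ### The cost as a smooth function of inputs and coefficients -/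

section Coef

variable {n m nd nz : ℕ}

/-- The finitely many real coefficients through which the parameters enter the problem:
`A_Δ`, `B_Δ`, `c_Δ`, `Q`, the initial state, the reference output, the disturbance, and the lower
and upper bounds on the inputs `v_k`. Matrices are stored as functions, which carry the sup norm. -/
abbrev Coef (n m nd : ℕ) : Type :=
  (Fin m → Fin m → ℝ) × (Fin m → Fin m → ℝ) × (Fin m → ℝ) ×
    (Fin n × Fin m → Fin n × Fin m → ℝ) × (Fin m → ℝ) × (Fin m → ℝ) × (Fin nd → ℝ) ×
    (Fin m → ℝ) × (Fin m → ℝ)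

namespace Coef

variable (θ : Coef n m nd)

/-- The state matrix `A_Δ`. -/
def a : Matrix (Fin m) (Fin m) ℝ := Matrix.of θ.1
/-- The input matrix `B_Δ`. -/
def b : Matrix (Fin m) (Fin m) ℝ := Matrix.of θ.2.1
/-- The affine term `c_Δ`. -/
def c : Fin m → ℝ := θ.2.2.1
/-- The tracking weight. -/
def Q : Matrix (Fin n × Fin m) (Fin n × Fin m) ℝ := Matrix.of θ.2.2.2.1
/-- The initial state. -/
def x₀ : Fin m → ℝ := θ.2.2.2.2.1
/-- The reference output. -/
def ref : Fin m → ℝ := θ.2.2.2.2.2.1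
/-- The disturbance. -/
def d : Fin nd → ℝ := θ.2.2.2.2.2.2.1
/-- The lower bound on the inputs. -/
def lo : Fin m → ℝ := θ.2.2.2.2.2.2.2.1
/-- The upper bound on the inputs. -/
def hi : Fin m → ℝ := θ.2.2.2.2.2.2.2.2

theorem contDiff_a {r : WithTop ℕ∞} (i j : Fin m) :
    ContDiff ℝ r fun θ : Coef n m nd => θ.a i j := by
  simp only [a, of_apply]; fun_prop
theorem contDiff_b {r : WithTop ℕ∞} (i j : Fin m) :
    ContDiff ℝ r fun θ : Coef n m nd => θ.b i j := by
  simp only [b, of_apply]; fun_prop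
theorem contDiff_c {r : WithTop ℕ∞} : ContDiff ℝ r fun θ : Coef n m nd => θ.c := by
  unfold c; fun_prop
theorem contDiff_Q {r : WithTop ℕ∞} (i j : Fin n × Fin m) :
    ContDiff ℝ r fun θ : Coef n m nd => θ.Q i j := by
  simp only [Q, of_apply]; fun_prop
theorem contDiff_x₀ {r : WithTop ℕ∞} : ContDiff ℝ r fun θ : Coef n m nd => θ.x₀ := by
  unfold x₀; fun_prop
theorem contDiff_ref {r : WithTop ℕ∞} : ContDiff ℝ r fun θ : Coef n m nd => θ.ref := by
  unfold ref; fun_prop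
theorem contDiff_d {r : WithTop ℕ∞} : ContDiff ℝ r fun θ : Coef n m nd => θ.d := by
  unfold d; fun_prop
theorem contDiff_lo {r : WithTop ℕ∞} : ContDiff ℝ r fun θ : Coef n m nd => θ.lo := by
  unfold lo; fun_prop
theorem contDiff_hi {r : WithTop ℕ∞} : ContDiff ℝ r fun θ : Coef n m nd => θ.hi := by
  unfold hi; fun_prop

/-- The tracking error. -/
def err (V : Fin n → Fin m → ℝ) : Fin n × Fin m → ℝ :=
  fun ki => trajectory θ.a θ.b θ.c θ.x₀ V (ki.1 + 1) ki.2 - θ.ref ki.2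

/-- The tracking cost `Eᵀ Q E`. -/
def tracking (V : Fin n → Fin m → ℝ) : ℝ := θ.err V ⬝ᵥ (θ.Q *ᵥ θ.err V)

/-- The network inputs `(x_k, v_k)`. -/
def netInput (V : Fin n → Fin m → ℝ) (k : Fin n) : Fin (m + m) → ℝ :=
  Fin.append (trajectory θ.a θ.b θ.c θ.x₀ V k) (V k)

/-- The affine parametrisation of the box of admissible inputs by the unit cube. -/
def box (t : Fin n → Fin m → ℝ) : Fin n → Fin m → ℝ :=
  fun k i => θ.lo i + (θ.hi i - θ.lo i) * t k i

variable {E : Type*} [NormedAddCommGroup E] [NormedSpace ℝ E] {r : WithTop ℕ∞}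
  {T : E → Coef n m nd} {V : E → Fin n → Fin m → ℝ}

theorem contDiff_trajectory (hT : ContDiff ℝ r T) (hV : ContDiff ℝ r V) (k : ℕ) :
    ContDiff ℝ r fun e => trajectory (T e).a (T e).b (T e).c (T e).x₀ (V e) k :=
  HW.contDiff_trajectory (fun i j => (contDiff_a i j).comp hT) (fun i j => (contDiff_b i j).comp hT)
    (contDiff_c.comp hT) (contDiff_x₀.comp hT) hV k

theorem contDiff_tracking (hT : ContDiff ℝ r T) (hV : ContDiff ℝ r V) :
    ContDiff ℝ r fun e => (T e).tracking (V e) := by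
  have h : ContDiff ℝ r fun e => (T e).err (V e) := contDiff_pi.2 fun ki =>
    (contDiff_pi.1 (contDiff_trajectory hT hV (ki.1 + 1)) ki.2).sub
      (contDiff_pi.1 (contDiff_ref.comp hT) ki.2)
  exact ContDiff.sum fun i _ => (contDiff_pi.1 h i).mul
    (contDiff_pi.1 (contDiff_mulVec (fun i j => (contDiff_Q i j).comp hT) h) i)

theorem contDiff_netInput (hT : ContDiff ℝ r T) (hV : ContDiff ℝ r V) (k : Fin n) :
    ContDiff ℝ r fun e => (T e).netInput (V e) k := by
  refine contDiff_pi.2 fun i => ?_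
  unfold netInput
  refine Fin.addCases (fun i => ?_) (fun i => ?_) i
  · simpa only [Fin.append_left] using contDiff_pi.1 (contDiff_trajectory hT hV k) i
  · simpa only [Fin.append_right] using contDiff_pi.1 (contDiff_pi.1 hV k) i

theorem contDiff_box (hT : ContDiff ℝ r T) (hV : ContDiff ℝ r V) :
    ContDiff ℝ r fun e => (T e).box (V e) := by
  refine contDiff_pi.2 fun k => contDiff_pi.2 fun i => ?_
  have h1 := contDiff_pi.1 (contDiff_lo.comp hT) i
  have h2 := contDiff_pi.1 (contDiff_hi.comp hT) i
  exact h1.add ((h2.sub h1).mul (contDiff_pi.1 (contDiff_pi.1 hV k) i))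

theorem continuous_trackingForm :
    Continuous fun q : (Fin n → Fin m → ℝ) × Coef n m nd =>
      trackingForm q.2.a q.2.b q.1 q.2.Q := by
  have hT : ContDiff ℝ 0 fun q : (Fin n → Fin m → ℝ) × Coef n m nd => q.2 := contDiff_snd
  have h : ∀ ki : Fin n × Fin m, ContDiff ℝ 0 fun q : (Fin n → Fin m → ℝ) × Coef n m nd =>
      trajectory q.2.a q.2.b 0 0 q.1 (ki.1 + 1) ki.2 := fun ki =>
    contDiff_pi.1 (HW.contDiff_trajectory (fun i j => (contDiff_a i j).comp hT)
      (fun i j => (contDiff_b i j).comp hT) contDiff_const contDiff_const contDiff_fst _) ki.2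
  refine ContDiff.continuous (𝕜 := ℝ) (n := 0) (ContDiff.sum fun i _ => (h i).mul ?_)
  exact contDiff_pi.1 (contDiff_mulVec (fun i j => (contDiff_Q i j).comp hT)
    (contDiff_pi.2 h)) i

theorem tracking_add_smul (V W : Fin n → Fin m → ℝ) :
    ∃ β, ∀ t : ℝ, θ.tracking (V + t • W)
      = θ.tracking V + t * β + t ^ 2 * trackingForm θ.a θ.b W θ.Q := by
  set e : Fin n × Fin m → ℝ := fun ki => trajectory θ.a θ.b 0 0 W (ki.1 + 1) ki.2 with he
  refine ⟨e ⬝ᵥ (θ.Q *ᵥ θ.err V) + θ.err V ⬝ᵥ (θ.Q *ᵥ e), fun t => ?_⟩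
  have h : θ.err (V + t • W) = θ.err V + t • e := by
    funext ki
    simp only [err, trajectory_add_smul, Pi.add_apply, Pi.smul_apply, he]
    ring
  simp only [tracking, h, trackingForm, ← he, mulVec_add, mulVec_smul, add_dotProduct,
    dotProduct_add, smul_dotProduct, dotProduct_smul, smul_eq_mul]
  ring

end Coef

namespace OCP

variable (P : OCP n m nd nz)

/-- The coefficients of the problem with parameters `p`. -/
def coef (p : Param m nd) : Coef n m nd :=
  (P.AΔ p.2.1, P.BΔ p.2.1, P.cΔ p.2.1, P.Q p, p.1, P.Φ.eval p.2.2 p.2.1, p.2.1, P.vlo p.2.1,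
    P.vhi p.2.1)

/-- The part of the cost other than the tracking cost. -/
def costRest (θ : Coef n m nd) (V : Fin n → Fin m → ℝ) : ℝ :=
  P.fv V θ.d + P.fz fun k => P.Ξ.eval (θ.netInput V k) θ.d

theorem cost_eq (V : Fin n → Fin m → ℝ) (p : Param m nd) :
    P.cost V p = (P.coef p).tracking V + P.costRest (P.coef p) V := by
  have h : P.err V p = (P.coef p).err V := by
    funext ki
    simp only [err, state_eq_trajectory]
    rfl
  have h' : P.outZ V p = fun k => P.Ξ.eval ((P.coef p).netInput V k) (P.coef p).d := by
    funext k
    simp only [outZ, state_eq_trajectory]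
    rfl
  rw [cost, h, h', add_assoc]
  rfl

theorem contDiff_costRest
    (hfv : ContDiff ℝ 2 (fun q : (Fin n → Fin m → ℝ) × (Fin nd → ℝ) => P.fv q.1 q.2))
    (hfz : ContDiff ℝ 2 P.fz) {E : Type*} [NormedAddCommGroup E] [NormedSpace ℝ E]
    {T : E → Coef n m nd} {V : E → Fin n → Fin m → ℝ} (hT : ContDiff ℝ 2 T)
    (hV : ContDiff ℝ 2 V) : ContDiff ℝ 2 fun e => P.costRest (T e) (V e) := by
  have hd := Coef.contDiff_d.comp hT
  refine (hfv.comp (hV.prodMk hd)).add (hfz.comp (contDiff_pi.2 fun k => ?_))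
  have h := Coef.contDiff_netInput hT hV k
  exact PICNNChain.contDiff_eval h P.Ξ h hd

theorem convexOn_costRest (hfvconv : ∀ d, ConvexOn ℝ Set.univ (fun V => P.fv V d))
    (hfzconv : ConvexOn ℝ Set.univ P.fz) (hfzmono : Monotone P.fz) (θ : Coef n m nd) :
    ConvexOn ℝ univ (P.costRest θ) := by
  refine (hfvconv θ.d).add (ConvexOn.comp_of_map_combo (g := θ.netInput)
    (f := fun y : Fin n → Fin (m + m) → ℝ => P.fz fun k => P.Ξ.eval (y k) θ.d) ?_ ?_)
  · refine ⟨convex_univ, fun x _ y _ s t hs ht hst => ?_⟩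
    refine le_trans (hfzmono fun k => ?_) (hfzconv.2 (mem_univ _) (mem_univ _) hs ht hst)
    exact (PICNN.convexOn_eval P.Ξ θ.d).2 (mem_univ (x k)) (mem_univ (y k)) hs ht hst
  · intro V W s t hst
    funext k i
    refine Fin.addCases (fun i => ?_) (fun i => ?_) i
    · simp [Coef.netInput, trajectory_combo _ _ _ _ _ _ hst]
    · simp only [Coef.netInput, Pi.add_apply, Pi.smul_apply, Fin.append_right]

/-- The gradient of the cost in the inputs is strongly monotone, with modulus twice the
second-order part of the tracking cost. -/
theorem two_mul_trackingForm_le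
    (hfv : ContDiff ℝ 2 (fun q : (Fin n → Fin m → ℝ) × (Fin nd → ℝ) => P.fv q.1 q.2))
    (hfvconv : ∀ d, ConvexOn ℝ Set.univ (fun V => P.fv V d))
    (hfz : ContDiff ℝ 2 P.fz) (hfzconv : ConvexOn ℝ Set.univ P.fz) (hfzmono : Monotone P.fz)
    (p : Param m nd) (V V' : Fin n → Fin m → ℝ) :
    2 * trackingForm (P.coef p).a (P.coef p).b (V - V') (P.coef p).Q ≤
      (fderiv ℝ (fun V => P.cost V p) V - fderiv ℝ (fun V => P.cost V p) V') (V - V') := by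
  have h1 : Differentiable ℝ (P.coef p).tracking :=
    (Coef.contDiff_tracking (r := 2) contDiff_const contDiff_id).differentiable two_ne_zero
  have h2 : Differentiable ℝ (P.costRest (P.coef p)) :=
    (P.contDiff_costRest hfv hfz contDiff_const contDiff_id).differentiable two_ne_zero
  have h3 : (fun V => P.cost V p) = (P.coef p).tracking + P.costRest (P.coef p) :=
    funext fun V => P.cost_eq V p
  obtain ⟨β, hβ⟩ := (P.coef p).tracking_add_smul V' (V - V')
  have h4 := fderiv_sub_apply_of_quadratic h1 V V' hβ
  have h5 := (P.convexOn_costRest hfvconv hfzconv hfzmono (P.coef p)).fderiv_monotone h2 V V'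
  rw [h3, fderiv_add (h1 V) (h2 V), fderiv_add (h1 V') (h2 V')]
  simp only [_root_.sub_apply, _root_.add_apply] at h4 h5 ⊢
  linarith

end OCP

end Coef

/-! ### The Fischer–Burmeister system as a variational inequality -/

theorem fischerBurmeister_eq_zero_iff {a b : ℝ} :
    fischerBurmeister a b = 0 ↔ 0 ≤ a ∧ 0 ≤ b ∧ a * b = 0 := by
  unfold fischerBurmeister
  rw [sub_eq_zero, eq_comm]
  constructor
  · intro h
    have h1 := Real.sq_sqrt (by positivity : 0 ≤ a ^ 2 + b ^ 2)
    have h2 := Real.abs_le_sqrt (by nlinarith [sq_nonneg b] : a ^ 2 ≤ a ^ 2 + b ^ 2)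
    have h3 := Real.abs_le_sqrt (by nlinarith [sq_nonneg a] : b ^ 2 ≤ a ^ 2 + b ^ 2)
    rw [h] at h1 h2 h3
    exact ⟨by linarith [le_abs_self b], by linarith [le_abs_self a], by linarith⟩
  · rintro ⟨ha, hb, hab⟩
    rw [show a ^ 2 + b ^ 2 = (a + b) ^ 2 by linear_combination (-2) * hab,
      Real.sqrt_sq (add_nonneg ha hb)]

namespace OCP

variable {n m nd nz : ℕ} (P : OCP n m nd nz)

/-- `V` satisfies the box constraints and the cost does not decrease to first order in any
feasible direction. -/
def IsStationary (V : Fin n → Fin m → ℝ) (p : Param m nd) : Prop :=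
  (∀ k i, V k i ∈ Icc (P.vlo p.2.1 i) (P.vhi p.2.1 i)) ∧
    ∀ V' : Fin n → Fin m → ℝ, (∀ k i, V' k i ∈ Icc (P.vlo p.2.1 i) (P.vhi p.2.1 i)) →
      0 ≤ fderiv ℝ (fun V => P.cost V p) V (V' - V)

/-- The directional derivative of the cost in the entry `(k, i)` of the inputs. -/
def partialCost (V : Fin n → Fin m → ℝ) (p : Param m nd) (k : Fin n) (i : Fin m) : ℝ :=
  fderiv ℝ (fun V => P.cost V p) V (Pi.single k (Pi.single i 1))

theorem fderiv_cost_apply (V W : Fin n → Fin m → ℝ) (p : Param m nd) :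
    fderiv ℝ (fun V => P.cost V p) V W = ∑ k, ∑ i, W k i * P.partialCost V p k i := by
  have h : W = ∑ k, ∑ i, W k i • (Pi.single k (Pi.single i (1 : ℝ)) : Fin n → Fin m → ℝ) := by
    funext k i
    simp [Finset.sum_apply, Pi.single_apply, ite_apply]
  conv_lhs => rw [h]
  simp only [map_sum, map_smul, smul_eq_mul, partialCost]

theorem fderiv_lagrangian_single {p : Param m nd} (hd : Differentiable ℝ fun V => P.cost V p)
    (V : Fin n → Fin m → ℝ) (lam : Mult n m) (k : Fin n) (i : Fin m) :
    fderiv ℝ (fun V => P.lagrangian V lam p) V (Pi.single k (Pi.single i 1))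
      = P.partialCost V p k i + lam (Sum.inl (k, i)) - lam (Sum.inr (k, i)) := by
  let L : (Fin n → Fin m → ℝ) →L[ℝ] ℝ := ∑ ki : Fin n × Fin m,
    (lam (Sum.inl ki) - lam (Sum.inr ki)) •
      (ContinuousLinearMap.proj (R := ℝ) (φ := fun _ : Fin m => ℝ) ki.2).comp
        (ContinuousLinearMap.proj (R := ℝ) (φ := fun _ : Fin n => Fin m → ℝ) ki.1)
  have hL : ∀ V, L V = ∑ ki : Fin n × Fin m,
      (lam (Sum.inl ki) - lam (Sum.inr ki)) * V ki.1 ki.2 := fun V => by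
    simp [L, _root_.sum_apply]
  have h1 : (fun V => P.lagrangian V lam p) = fun V => P.cost V p + (L V +
      ∑ ki : Fin n × Fin m, (lam (Sum.inr ki) * P.vlo p.2.1 ki.2 -
        lam (Sum.inl ki) * P.vhi p.2.1 ki.2)) := by
    funext V
    rw [lagrangian, hL, dotProduct, Fintype.sum_sum_type, ← Finset.sum_add_distrib,
      ← Finset.sum_add_distrib]
    congr 1
    refine Finset.sum_congr rfl fun ki _ => ?_
    simp only [constr, Sum.elim_inl, Sum.elim_inr]
    ring
  have h2 := (hd V).hasFDerivAt.add (L.hasFDerivAt.add_const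
    (∑ ki : Fin n × Fin m, (lam (Sum.inr ki) * P.vlo p.2.1 ki.2 -
        lam (Sum.inl ki) * P.vhi p.2.1 ki.2)) (x := V))
  have h3 : L (Pi.single k (Pi.single i 1)) = lam (Sum.inl (k, i)) - lam (Sum.inr (k, i)) := by
    rw [hL, Finset.sum_eq_single (k, i)]
    · simp
    · rintro ⟨k', i'⟩ - h
      rcases eq_or_ne k' k with rfl | hk
      · have : i' ≠ i := fun hi => h (by rw [hi])
        simp [this]
      · simp [hk]
    · simp
  rw [h1]
  change fderiv ℝ ((fun V => P.cost V p) + fun V => L V + _) V _ = _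
  rw [h2.fderiv, _root_.add_apply, h3, partialCost]
  ring

/-- The Fischer–Burmeister system is the system of Karush–Kuhn–Tucker conditions. -/
theorem F_eq_zero_iff {p : Param m nd} (hd : Differentiable ℝ fun V => P.cost V p)
    (V : Fin n → Fin m → ℝ) (lam : Mult n m) :
    P.F (V, lam) p = 0 ↔ ∀ k i,
      P.partialCost V p k i + lam (Sum.inl (k, i)) - lam (Sum.inr (k, i)) = 0 ∧
      (0 ≤ lam (Sum.inl (k, i)) ∧ 0 ≤ P.vhi p.2.1 i - V k i ∧
        lam (Sum.inl (k, i)) * (P.vhi p.2.1 i - V k i) = 0) ∧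
      (0 ≤ lam (Sum.inr (k, i)) ∧ 0 ≤ V k i - P.vlo p.2.1 i ∧
        lam (Sum.inr (k, i)) * (V k i - P.vlo p.2.1 i) = 0) := by
  simp only [F, Prod.mk_eq_zero, funext_iff, Pi.zero_apply, P.fderiv_lagrangian_single hd,
    Sum.forall, Prod.forall, constr, Sum.elim_inl, Sum.elim_inr, neg_sub,
    fischerBurmeister_eq_zero_iff]
  constructor
  · rintro ⟨h1, h2, h3⟩ k i
    exact ⟨h1 k i, h2 k i, h3 k i⟩
  · intro h
    exact ⟨fun k i => (h k i).1, fun k i => (h k i).2.1, fun k i => (h k i).2.2⟩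

theorem isStationary_of_F_eq_zero {p : Param m nd} (hd : Differentiable ℝ fun V => P.cost V p)
    {V : Fin n → Fin m → ℝ} {lam : Mult n m} (h : P.F (V, lam) p = 0) : P.IsStationary V p := by
  rw [P.F_eq_zero_iff hd] at h
  refine ⟨fun k i => ?_, fun V' hV' => ?_⟩
  · obtain ⟨-, ⟨-, h1, -⟩, -, h2, -⟩ := h k i
    exact ⟨by linarith, by linarith⟩
  · rw [fderiv_cost_apply]
    refine Finset.sum_nonneg fun k _ => Finset.sum_nonneg fun i _ => ?_
    obtain ⟨h1, ⟨h2, -, h3⟩, h4, -, h5⟩ := h k i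
    obtain ⟨h6, h7⟩ := hV' k i
    have h8 := mul_nonneg h2 (sub_nonneg.2 h7)
    have h9 := mul_nonneg h4 (sub_nonneg.2 h6)
    have h10 : P.partialCost V p k i = lam (Sum.inr (k, i)) - lam (Sum.inl (k, i)) := by linarith
    rw [h10, Pi.sub_apply, Pi.sub_apply]
    linarith

/-- At a stationary point the negative and the positive part of the gradient are multipliers of
the upper and of the lower bounds. -/
theorem IsStationary.exists_F_eq_zero {p : Param m nd}
    (hd : Differentiable ℝ fun V => P.cost V p) {V : Fin n → Fin m → ℝ}
    (h : P.IsStationary V p) : ∃ lam : Mult n m, P.F (V, lam) p = 0 := by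
  obtain ⟨hbox, hvi⟩ := h
  have key : ∀ k i, ∀ s ∈ Icc (P.vlo p.2.1 i) (P.vhi p.2.1 i),
      0 ≤ (s - V k i) * P.partialCost V p k i := by
    intro k i s hs
    -- vary only the entry `(k, i)`
    have h1 := hvi
        (V + (s - V k i) • (Pi.single k (Pi.single i (1 : ℝ)) : Fin n → Fin m → ℝ)) fun k' i' => by
      rcases eq_or_ne k' k with rfl | hk
      · rcases eq_or_ne i' i with rfl | hi
        · simpa using hs
        · simpa [hi] using hbox k' i'
      · simpa [hk] using hbox k' i'
    rwa [add_sub_cancel_left, map_smul, smul_eq_mul] at h1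
  refine ⟨Sum.elim (fun ki => max (-P.partialCost V p ki.1 ki.2) 0)
    (fun ki => max (P.partialCost V p ki.1 ki.2) 0), (P.F_eq_zero_iff hd _ _).2 fun k i => ?_⟩
  obtain ⟨h1, h2⟩ := hbox k i
  have h3 := key k i _ (left_mem_Icc.2 (h1.trans h2))
  have h4 := key k i _ (right_mem_Icc.2 (h1.trans h2))
  simp only [Sum.elim_inl, Sum.elim_inr]
  rcases le_total 0 (P.partialCost V p k i) with hg | hg
  · rw [max_eq_right (neg_nonpos.2 hg), max_eq_left hg]
    refine ⟨by ring, ⟨le_rfl, by linarith, zero_mul _⟩, hg, by linarith, ?_⟩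
    exact le_antisymm (by linarith) (mul_nonneg hg (by linarith))
  · rw [max_eq_left (neg_nonneg.2 hg), max_eq_right hg]
    refine ⟨by ring, ⟨by linarith, by linarith, ?_⟩, le_rfl, by linarith, zero_mul _⟩
    exact le_antisymm (by linarith) (mul_nonneg (by linarith) (by linarith))

/-- Since the box is nondegenerate, at most one of the two bounds on an entry is active, so the
multipliers are determined by the gradient. -/
theorem multiplier_unique {p : Param m nd} (hd : Differentiable ℝ fun V => P.cost V p)
    (hlt : ∀ i, P.vlo p.2.1 i < P.vhi p.2.1 i) {V : Fin n → Fin m → ℝ} {lam lam' : Mult n m}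
    (h : P.F (V, lam) p = 0) (h' : P.F (V, lam') p = 0) : lam = lam' := by
  rw [P.F_eq_zero_iff hd] at h h'
  have key : ∀ k i, lam (Sum.inl (k, i)) = lam' (Sum.inl (k, i)) ∧
      lam (Sum.inr (k, i)) = lam' (Sum.inr (k, i)) := by
    intro k i
    obtain ⟨h1, ⟨-, -, h2⟩, -, -, h3⟩ := h k i
    obtain ⟨h1', ⟨-, -, h2'⟩, -, -, h3'⟩ := h' k i
    rcases eq_or_ne (P.vhi p.2.1 i - V k i) 0 with hv | hv
    · have hv' : V k i - P.vlo p.2.1 i ≠ 0 := by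
        have := hlt i
        exact fun h0 => by linarith
      have h4 := (mul_eq_zero.1 h3).resolve_right hv'
      have h4' := (mul_eq_zero.1 h3').resolve_right hv'
      exact ⟨by linarith, by linarith⟩
    · have h4 := (mul_eq_zero.1 h2).resolve_right hv
      have h4' := (mul_eq_zero.1 h2').resolve_right hv
      exact ⟨by linarith, by linarith⟩
  funext j
  rcases j with ⟨k, i⟩ | ⟨k, i⟩
  · exact (key k i).1
  · exact (key k i).2

theorem exists_isStationary {p : Param m nd} (hd : Differentiable ℝ fun V => P.cost V p)
    (hle : ∀ i, P.vlo p.2.1 i ≤ P.vhi p.2.1 i) : ∃ V : Fin n → Fin m → ℝ, P.IsStationary V p := by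
  set lo : Fin n → Fin m → ℝ := fun _ => P.vlo p.2.1 with hlo
  set hi : Fin n → Fin m → ℝ := fun _ => P.vhi p.2.1 with hhi
  have hmem : ∀ V : Fin n → Fin m → ℝ,
      V ∈ Icc lo hi ↔ ∀ k i, V k i ∈ Icc (P.vlo p.2.1 i) (P.vhi p.2.1 i) := fun V =>
    ⟨fun h k i => ⟨h.1 k i, h.2 k i⟩, fun h => ⟨fun k i => (h k i).1, fun k i => (h k i).2⟩⟩
  obtain ⟨V, hV, hmin⟩ := (isCompact_Icc (a := lo) (b := hi)).exists_isMinOn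
    ⟨lo, le_rfl, fun _ => hle⟩ hd.continuous.continuousOn
  refine ⟨V, (hmem V).1 hV, fun V' hV' => ?_⟩
  exact hmin.localize.hasFDerivWithinAt_nonneg (hd V).hasFDerivAt.hasFDerivWithinAt
    (sub_mem_posTangentConeAt_of_segment_subset
      ((convex_Icc lo hi).segment_subset hV ((hmem V').2 hV')))

/-! ### Existence, uniqueness and Lipschitz dependence of the solution -/

theorem differentiable_cost
    (hfv : ContDiff ℝ 2 (fun q : (Fin n → Fin m → ℝ) × (Fin nd → ℝ) => P.fv q.1 q.2))
    (hfz : ContDiff ℝ 2 P.fz) (p : Param m nd) : Differentiable ℝ fun V => P.cost V p := by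
  simp only [cost_eq]
  exact ((Coef.contDiff_tracking contDiff_const contDiff_id).add
    (P.contDiff_costRest hfv hfz contDiff_const contDiff_id)).differentiable two_ne_zero

theorem trackingForm_coef_pos {p : Param m nd} (hp : p ∈ P.regular) (hQ : (P.Q p).PosDef)
    {W : Fin n → Fin m → ℝ} (hW : W ≠ 0) :
    0 < trackingForm (P.coef p).a (P.coef p).b W (P.coef p).Q :=
  trackingForm_pos _ hp hQ hW

theorem IsStationary.eq {P : OCP n m nd nz}
    (hfv : ContDiff ℝ 2 (fun q : (Fin n → Fin m → ℝ) × (Fin nd → ℝ) => P.fv q.1 q.2))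
    (hfvconv : ∀ d, ConvexOn ℝ Set.univ (fun V => P.fv V d))
    (hfz : ContDiff ℝ 2 P.fz) (hfzconv : ConvexOn ℝ Set.univ P.fz) (hfzmono : Monotone P.fz)
    {p : Param m nd} (hp : p ∈ P.regular) (hQ : (P.Q p).PosDef) {V V' : Fin n → Fin m → ℝ}
    (h : P.IsStationary V p) (h' : P.IsStationary V' p) : V = V' := by
  by_contra hne
  have h1 := P.trackingForm_coef_pos hp hQ (sub_ne_zero.2 hne)
  have h2 := P.two_mul_trackingForm_le hfv hfvconv hfz hfzconv hfzmono p V V'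
  have h3 := h.2 V' h'.1
  have h4 := h'.2 V h.1
  rw [← neg_sub V V', map_neg] at h3
  rw [_root_.sub_apply] at h2
  linarith

theorem locallyLipschitz_coef (hΨ : P.Ψ.IsOfClass 2) (hΦ : P.Φ.IsOfClass 2)
    (hA : ∀ i j, LocallyLipschitz (fun d => P.A d i j))
    (hB : ∀ i j, LocallyLipschitz (fun d => P.B d i j)) (hc : LocallyLipschitz P.c)
    (hQlip : ∀ a b, LocallyLipschitzOn P.regular (fun p => P.Q p a b)) :
    LocallyLipschitz fun p : P.regular => P.coef p := by
  have hval : LocallyLipschitz fun p : P.regular => (p : Param m nd) :=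
    (LipschitzWith.subtype_val _).locallyLipschitz
  have hd : LocallyLipschitz fun p : P.regular => (p : Param m nd).2.1 :=
    (LipschitzWith.prod_fst.locallyLipschitz.comp LipschitzWith.prod_snd.locallyLipschitz).comp hval
  refine .prodMk ?_ <| .prodMk ?_ <| .prodMk ?_ <| .prodMk ?_ <| .prodMk ?_ <| .prodMk ?_ <|
    .prodMk ?_ <| .prodMk ?_ ?_
  · exact locallyLipschitz_pi fun i => locallyLipschitz_pi fun j =>
      (P.locallyLipschitz_AΔ hA i j).comp hd
  · exact locallyLipschitz_pi fun i => locallyLipschitz_pi fun j =>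
      (P.locallyLipschitz_BΔ hA hB i j).comp hd
  · exact (P.locallyLipschitz_cΔ hA hc).comp hd
  · exact locallyLipschitz_pi fun i => locallyLipschitz_pi fun j =>
      locallyLipschitzOn_iff_restrict.1 (hQlip i j)
  · exact LipschitzWith.prod_fst.locallyLipschitz.comp hval
  · have h : ContDiff ℝ 1 fun p : Param m nd => P.Φ.eval p.2.2 p.2.1 :=
      (P.Φ.contDiff_eval hΦ (by fun_prop) (by fun_prop)).of_le one_le_two
    exact h.locallyLipschitz.comp hval
  · exact hd
  · exact (P.locallyLipschitz_vlo hΨ).comp hd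
  · exact (P.locallyLipschitz_vhi hΨ).comp hd

end OCP

variable {n m nd nz : ℕ}

/-- The linear part of the parametrisation `Coef.box`. -/
def Coef.scale (θ : Coef n m nd) : (Fin n → Fin m → ℝ) →L[ℝ] (Fin n → Fin m → ℝ) :=
  LinearMap.toContinuousLinearMap
    { toFun := fun W k i => (θ.hi i - θ.lo i) * W k i
      map_add' := fun V W => by funext k i; simp only [Pi.add_apply]; ring
      map_smul' := fun r W => by
        funext k i; simp only [Pi.smul_apply, smul_eq_mul, RingHom.id_apply]; ring }

theorem Coef.scale_apply (θ : Coef n m nd) (W : Fin n → Fin m → ℝ) :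
    θ.scale W = fun k i => (θ.hi i - θ.lo i) * W k i := rfl

theorem Coef.hasFDerivAt_box (θ : Coef n m nd) (t : Fin n → Fin m → ℝ) :
    HasFDerivAt θ.box θ.scale t :=
  θ.scale.hasFDerivAt.const_add (fun _ => θ.lo)

theorem Coef.box_sub_box (θ : Coef n m nd) (t t' : Fin n → Fin m → ℝ) :
    θ.box t - θ.box t' = θ.scale (t - t') := by
  funext k i
  simp only [box, scale_apply, Pi.sub_apply]
  ring

namespace OCP

variable (P : OCP n m nd nz)

/-- The cost as a function of a point of the unit cube and of the coefficients. -/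
def cubeCost (θ : Coef n m nd) (t : Fin n → Fin m → ℝ) : ℝ :=
  θ.tracking (θ.box t) + P.costRest θ (θ.box t)

theorem contDiff_fderiv_cubeCost
    (hfv : ContDiff ℝ 2 (fun q : (Fin n → Fin m → ℝ) × (Fin nd → ℝ) => P.fv q.1 q.2))
    (hfz : ContDiff ℝ 2 P.fz) :
    ContDiff ℝ 1 fun q : (Fin n → Fin m → ℝ) × Coef n m nd => fderiv ℝ (P.cubeCost q.2) q.1 := by
  have h1 : ContDiff ℝ 2 fun e : ((Fin n → Fin m → ℝ) × Coef n m nd) × (Fin n → Fin m → ℝ) =>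
    e.1.2 := by fun_prop
  have h2 := Coef.contDiff_box h1 contDiff_snd
  have h3 : ContDiff ℝ 2 (Function.uncurry fun (q : (Fin n → Fin m → ℝ) × Coef n m nd)
      (t : Fin n → Fin m → ℝ) => P.cubeCost q.2 t) :=
    (Coef.contDiff_tracking h1 h2).add (P.contDiff_costRest hfv hfz h1 h2)
  exact h3.fderiv contDiff_fst le_rfl

theorem fderiv_cubeCost_apply
    (hfv : ContDiff ℝ 2 (fun q : (Fin n → Fin m → ℝ) × (Fin nd → ℝ) => P.fv q.1 q.2))
    (hfz : ContDiff ℝ 2 P.fz) (p : Param m nd) (t W : Fin n → Fin m → ℝ) :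
    fderiv ℝ (P.cubeCost (P.coef p)) t W =
      fderiv ℝ (fun V => P.cost V p) ((P.coef p).box t) ((P.coef p).scale W) := by
  have h1 : P.cubeCost (P.coef p) = (fun V => P.cost V p) ∘ (P.coef p).box :=
    funext fun t => (P.cost_eq _ p).symm
  rw [h1, ((P.differentiable_cost hfv hfz p _).hasFDerivAt.comp t
    ((P.coef p).hasFDerivAt_box t)).fderiv]
  rfl

end OCP

/-- Twice the second-order part of the tracking cost, in the coordinates of the unit cube. It is
the modulus of strong monotonicity of the gradient of `OCP.cubeCost`. -/
def Coef.cubeForm (θ : Coef n m nd) (W : Fin n → Fin m → ℝ) : ℝ :=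
  2 * trackingForm θ.a θ.b (θ.scale W) θ.Q

theorem Coef.continuous_cubeForm :
    Continuous fun q : (Fin n → Fin m → ℝ) × Coef n m nd => q.2.cubeForm q.1 := by
  have h1 : Continuous fun q : (Fin n → Fin m → ℝ) × Coef n m nd => q.2.lo :=
    (ContDiff.continuous (𝕜 := ℝ) (n := 0) Coef.contDiff_lo).comp continuous_snd
  have h2 : Continuous fun q : (Fin n → Fin m → ℝ) × Coef n m nd => q.2.hi :=
    (ContDiff.continuous (𝕜 := ℝ) (n := 0) Coef.contDiff_hi).comp continuous_snd
  have h3 : Continuous fun q : (Fin n → Fin m → ℝ) × Coef n m nd => q.2.scale q.1 := by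
    simp only [scale_apply]
    fun_prop
  have h4 : Continuous fun q : (Fin n → Fin m → ℝ) × Coef n m nd => (q.2.scale q.1, q.2) :=
    h3.prodMk continuous_snd
  have h5 := Coef.continuous_trackingForm.comp h4
  simp only [cubeForm]
  exact continuous_const.mul h5

theorem Coef.cubeForm_smul (θ : Coef n m nd) (r : ℝ) (W : Fin n → Fin m → ℝ) :
    θ.cubeForm (r • W) = r ^ 2 * θ.cubeForm W := by
  rw [cubeForm, map_smul, trackingForm_smul, cubeForm]
  ring

namespace OCP

variable (P : OCP n m nd nz)

theorem cubeForm_coef_pos {p : Param m nd} (hp : p ∈ P.regular) (hQ : (P.Q p).PosDef)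
    (hlt : ∀ i, P.vlo p.2.1 i < P.vhi p.2.1 i) {W : Fin n → Fin m → ℝ} (hW : W ≠ 0) :
    0 < (P.coef p).cubeForm W := by
  refine mul_pos two_pos (P.trackingForm_coef_pos hp hQ fun h0 => hW ?_)
  funext k i
  exact (mul_eq_zero.1 (congrFun (congrFun h0 k) i)).resolve_left (sub_pos.2 (hlt i)).ne'

theorem cubeForm_le
    (hfv : ContDiff ℝ 2 (fun q : (Fin n → Fin m → ℝ) × (Fin nd → ℝ) => P.fv q.1 q.2))
    (hfvconv : ∀ d, ConvexOn ℝ Set.univ (fun V => P.fv V d))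
    (hfz : ContDiff ℝ 2 P.fz) (hfzconv : ConvexOn ℝ Set.univ P.fz) (hfzmono : Monotone P.fz)
    (p : Param m nd) (t t' : Fin n → Fin m → ℝ) :
    (P.coef p).cubeForm (t - t') ≤
      (fderiv ℝ (P.cubeCost (P.coef p)) t - fderiv ℝ (P.cubeCost (P.coef p)) t') (t - t') := by
  have h := P.two_mul_trackingForm_le hfv hfvconv hfz hfzconv hfzmono p
    ((P.coef p).box t) ((P.coef p).box t')
  rw [Coef.box_sub_box, _root_.sub_apply] at h
  rw [_root_.sub_apply, P.fderiv_cubeCost_apply hfv hfz, P.fderiv_cubeCost_apply hfv hfz]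
  exact h

theorem box_mem {p : Param m nd} (hle : ∀ i, P.vlo p.2.1 i ≤ P.vhi p.2.1 i)
    {t : Fin n → Fin m → ℝ} (ht : t ∈ Icc (fun _ _ => 0 : Fin n → Fin m → ℝ) fun _ _ => 1)
    (k : Fin n) (i : Fin m) :
    (P.coef p).box t k i ∈ Icc (P.vlo p.2.1 i) (P.vhi p.2.1 i) := by
  have h0 := sub_nonneg.2 (hle i)
  refine ⟨le_add_of_nonneg_right (mul_nonneg h0 (ht.1 k i)), ?_⟩
  have := mul_le_mul_of_nonneg_left (ht.2 k i) h0
  change P.vlo p.2.1 i + (P.vhi p.2.1 i - P.vlo p.2.1 i) * t k i ≤ P.vhi p.2.1 i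
  linarith

/-- Division by the width of the box is legitimate because the box is nondegenerate. -/
theorem exists_box_eq {p : Param m nd} (hlt : ∀ i, P.vlo p.2.1 i < P.vhi p.2.1 i)
    {V : Fin n → Fin m → ℝ} (hV : ∀ k i, V k i ∈ Icc (P.vlo p.2.1 i) (P.vhi p.2.1 i)) :
    ∃ t ∈ Icc (fun _ _ => 0 : Fin n → Fin m → ℝ) fun _ _ => 1, (P.coef p).box t = V := by
  have h0 : ∀ i, 0 < P.vhi p.2.1 i - P.vlo p.2.1 i := fun i => sub_pos.2 (hlt i)
  refine ⟨fun k i => (V k i - P.vlo p.2.1 i) / (P.vhi p.2.1 i - P.vlo p.2.1 i),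
    ⟨fun k i => div_nonneg (sub_nonneg.2 (hV k i).1) (h0 i).le,
      fun k i => (div_le_one (h0 i)).2 (sub_le_sub_right (hV k i).2 _)⟩, ?_⟩
  funext k i
  change P.vlo p.2.1 i + (P.vhi p.2.1 i - P.vlo p.2.1 i) *
    ((V k i - P.vlo p.2.1 i) / (P.vhi p.2.1 i - P.vlo p.2.1 i)) = V k i
  rw [mul_div_cancel₀ _ (h0 i).ne', add_sub_cancel]

/-- Stationary points depend on the parameters in a locally Lipschitz way. The box of admissible
inputs moves with the parameters, so the problem is transported to the unit cube first. -/
theorem locallyLipschitz_of_isStationary (hΨd : P.Ψ.IsDiagonal) (hΨ : P.Ψ.IsOfClass 2)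
    (hΦ : P.Φ.IsOfClass 2)
    (hA : ∀ i j, LocallyLipschitz (fun d => P.A d i j))
    (hB : ∀ i j, LocallyLipschitz (fun d => P.B d i j)) (hc : LocallyLipschitz P.c)
    (hQ : ∀ p ∈ P.regular, (P.Q p).PosDef)
    (hQlip : ∀ a b, LocallyLipschitzOn P.regular (fun p => P.Q p a b))
    (hfv : ContDiff ℝ 2 (fun q : (Fin n → Fin m → ℝ) × (Fin nd → ℝ) => P.fv q.1 q.2))
    (hfvconv : ∀ d, ConvexOn ℝ Set.univ (fun V => P.fv V d))
    (hfz : ContDiff ℝ 2 P.fz) (hfzconv : ConvexOn ℝ Set.univ P.fz) (hfzmono : Monotone P.fz)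
    (hu : ∀ i, P.ulo i < P.uhi i) {V : P.regular → Fin n → Fin m → ℝ}
    (hV : ∀ p : P.regular, P.IsStationary (V p) p) : LocallyLipschitz V := by
  have hcoef := P.locallyLipschitz_coef hΨ hΦ hA hB hc hQlip
  have hlt : ∀ (p : Param m nd) i, P.vlo p.2.1 i < P.vhi p.2.1 i := fun p i =>
    P.vlo_lt_vhi hΨd hΨ hu _ i
  choose τ hτ hbox using fun p : P.regular => P.exists_box_eq (hlt p) (hV p).1
  have hpair : LocallyLipschitz fun q : (Fin n → Fin m → ℝ) × P.regular => (q.1, P.coef q.2) :=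
    LipschitzWith.prod_fst.locallyLipschitz.prodMk
      (hcoef.comp LipschitzWith.prod_snd.locallyLipschitz)
  have hgrad : LocallyLipschitz fun q : (Fin n → Fin m → ℝ) × Coef n m nd =>
      fderiv ℝ (P.cubeCost q.2) q.1 := (P.contDiff_fderiv_cubeCost hfv hfz).locallyLipschitz
  have hH := hgrad.comp hpair
  have hq := Coef.continuous_cubeForm.comp hpair.continuous
  have hlip : LocallyLipschitz τ := by
    refine locallyLipschitz_of_variationalInequality isCompact_Icc hH hq
      (fun r W p => (P.coef p).cubeForm_smul r W)
      (fun W p hW => P.cubeForm_coef_pos p.2 (hQ p p.2) (hlt p) hW)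
      (fun t t' p => P.cubeForm_le hfv hfvconv hfz hfzconv hfzmono p t t') hτ
      (fun p t ht => ?_)
    change 0 ≤ fderiv ℝ (P.cubeCost (P.coef p)) (τ p) (t - τ p)
    rw [P.fderiv_cubeCost_apply hfv hfz, ← Coef.box_sub_box, hbox]
    exact (hV p).2 _ (P.box_mem (fun i => (hlt p i).le) ht)
  have hsmooth : LocallyLipschitz fun q : (Fin n → Fin m → ℝ) × Coef n m nd => q.2.box q.1 :=
    (Coef.contDiff_box (r := 1) contDiff_snd contDiff_fst).locallyLipschitz
  rw [show V = fun p : P.regular => (P.coef p).box (τ p) from funext fun p => (hbox p).symm]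
  -- `(… :)` keeps the unifier from splitting the goal into a composition by itself
  exact (hsmooth.comp (hlip.prodMk hcoef) :)

end OCP

theorem BNN.locallyLipschitz_inv {m p : ℕ} {N : BNN m p} (hN : N.IsOfClass 2)
    (hjac : ∀ d u, Function.Bijective (fderiv ℝ (fun u' => N.eval u' d) u)) :
    LocallyLipschitz fun q : (Fin m → ℝ) × (Fin p → ℝ) => N.inv q.1 q.2 :=
  HW.locallyLipschitz_inv (f := N.eval)
    ((N.contDiff_eval hN contDiff_fst contDiff_snd).of_le one_le_two) hjac
    (fun x d => (Equiv.ofBijective _ (N.eval_bijective d)).symm_apply_apply x)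
    (fun y d => (Equiv.ofBijective _ (N.eval_bijective d)).apply_symm_apply y)

end HW

end

theorem mainTheorem2 {n m nd nz : ℕ} (hn : 0 < n) (P : HW.OCP n m nd nz)
    (hΔ : 0 < P.Δ)
    -- the networks
    (hΨdiag : P.Ψ.IsDiagonal) (hΨ : P.Ψ.IsOfClass 2)
    (hΨjac : ∀ d u, Function.Bijective (fderiv ℝ (fun u' => P.Ψ.eval u' d) u))
    (hΦ : P.Φ.IsOfClass 2)
    -- the linear dynamics depend on the disturbance in a locally Lipschitz way
    (hA : ∀ i j, LocallyLipschitz (fun d => P.A d i j))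
    (hB : ∀ i j, LocallyLipschitz (fun d => P.B d i j))
    (hc : LocallyLipschitz P.c)
    -- the costs and the input bounds
    (hQ : ∀ p ∈ P.regular, (P.Q p).PosDef)
    (hQlip : ∀ a b, LocallyLipschitzOn P.regular (fun p => P.Q p a b))
    (hfv : ContDiff ℝ 2 (fun q : (Fin n → Fin m → ℝ) × (Fin nd → ℝ) => P.fv q.1 q.2))
    (hfvconv : ∀ d, ConvexOn ℝ Set.univ (fun V => P.fv V d))
    (hfz : ContDiff ℝ 2 P.fz) (hfzconv : ConvexOn ℝ Set.univ P.fz) (hfzmono : Monotone P.fz)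
    (hu : ∀ i, P.ulo i < P.uhi i) :
    (∀ p ∈ P.regular, ∃! w : (Fin n → Fin m → ℝ) × HW.Mult n m, P.F w p = 0) ∧
    ∀ Vstar : HW.Param m nd → (Fin n → Fin m → ℝ) × HW.Mult n m,
      (∀ p ∈ P.regular, P.F (Vstar p) p = 0) →
      LocallyLipschitzOn P.regular (fun p => P.Ψ.inv ((Vstar p).1 ⟨0, hn⟩) p.2.1) := by
  have hd := P.differentiable_cost hfv hfz
  refine ⟨fun p hp => ?_, fun Vstar hV => ?_⟩
  · have hlt := P.vlo_lt_vhi hΨdiag hΨ hu p.2.1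
    obtain ⟨V, hV⟩ := P.exists_isStationary (hd p) fun i => (hlt i).le
    obtain ⟨lam, hlam⟩ := hV.exists_F_eq_zero P (hd p)
    refine ⟨(V, lam), hlam, ?_⟩
    rintro ⟨V', lam'⟩ h
    obtain rfl : V' = V := (P.isStationary_of_F_eq_zero (hd p) h).eq hfv hfvconv hfz hfzconv
      hfzmono hp (hQ p hp) hV
    rw [P.multiplier_unique (hd p) hlt h hlam]
  · have h1 : LocallyLipschitz fun p : P.regular => (Vstar p).1 :=
      P.locallyLipschitz_of_isStationary hΨdiag hΨ hΦ hA hB hc hQ hQlip hfv hfvconv hfz hfzconv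
        hfzmono hu fun p => P.isStationary_of_F_eq_zero (hd p) (hV p p.2)
    have h2 : LocallyLipschitz fun p : P.regular => (Vstar p).1 ⟨0, hn⟩ :=
      (LipschitzWith.eval (⟨0, hn⟩ : Fin n)).locallyLipschitz.comp h1
    have h3 : LocallyLipschitz fun p : P.regular => (p : HW.Param m nd).2.1 :=
      (LipschitzWith.prod_fst.comp
        (LipschitzWith.prod_snd.comp (LipschitzWith.subtype_val _))).locallyLipschitz
    exact locallyLipschitzOn_iff_restrict.2
      ((HW.BNN.locallyLipschitz_inv hΨ hΨjac).comp (h2.prodMk h3) :)
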